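/- Let $m,n\ge 1$ be integers, let $a>1$ be a real number, and let $\mathcal{A}_n^{(m)}$ be the hyperplane arrangement in $\mathbb{R}^n$ $$\mathcal{A}_n^{(m)}=\{x_i=0 \mid 1\le i\le n\}\cup\{x_i=a^kx_j \mid k\in\mathbb{Z},\ -m\le k\le m,\ 1\le i<j\le n\}.$$ Let $\chi_{\mathcal{A}_n^{(m)}}(t)=\sum_{x}\mu(\hat 0,x)\,t^{\dim x}$ be its characteristic polynomial, where $x$ ranges over all flats (nonempty intersections of subcollections of the hyperplanes, including $\hat 0=\mathbb{R}^n$), ordered by reverse inclusion, and $\mu$ is the Möbius function of this poset. A labeled $m$-Dyck path with label set $S$, where $S$ is a finite set of positive integers, is a sequence consisting of $|S|$ terms $+m$ (up-steps) and $m|S|$ terms $-1$ (down-steps), all of whose prefixes have nonnegative sum, together with a bijective labeling of the up-steps by $S$. Such a path breaks up into primitive parts at its returns to height $0$. Its compartments are obtained as follows: the first compartment consists of the primitive parts up to and including the one containing the largest label; if primitive parts remain, the next compartment consists of the remaining parts up to and including the one containing the largest label among the remaining parts; and so on. (The empty path has no compartments.) A decorated $m$-Dyck path of size $n$ is a labeled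 $m$-Dyck path with label set $\{1,\dots,n\}$ together with a chosen point of the path lying on the $x$-axis; its second labeled Dyck path is the part of the path after the chosen point. Then for every integer $j\ge 0$, the absolute value of the coefficient of $t^j$ in $\chi_{\mathcal{A}_n^{(m)}}(t)$ equals the number of decorated $m$-Dyck paths of size $n$ whose second labeled Dyck path has exactly $j$ compartments. -/

import Mathlib

open Polynomial

/-! ### Hyperplane arrangements and the characteristic polynomial -/

/-- A hyperplane arrangement in `ℝⁿ`: a finite collection of affine subspaces of codimension one. -/
structure HyperplaneArrangement (n : ℕ) where
  hyperplanes : Set (AffineSubspace ℝ (Fin n → ℝ))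
  finite : hyperplanes.Finite
  nonempty : ∀ H ∈ hyperplanes, (H : Set (Fin n → ℝ)).Nonempty
  codim_one : ∀ H ∈ hyperplanes, Module.finrank ℝ H.direction + 1 = n

namespace HyperplaneArrangement

variable {n : ℕ}

/-- A flat: a nonempty intersection of some (possibly none) of the hyperplanes. -/
def IsFlat (A : HyperplaneArrangement n) (x : AffineSubspace ℝ (Fin n → ℝ)) : Prop :=
  (x : Set (Fin n → ℝ)).Nonempty ∧ ∃ T ⊆ A.hyperplanes, x = sInf T

/-- The intersection poset: the flats ordered by reverse inclusion. -/
abbrev IntersectionPoset (A : HyperplaneArrangement n) : Type :=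
  {x : AffineSubspace ℝ (Fin n → ℝ) // A.IsFlat x}ᵒᵈ

/-- The flat underlying an element of the intersection poset. -/
def IntersectionPoset.flat {A : HyperplaneArrangement n} (x : A.IntersectionPoset) :
    AffineSubspace ℝ (Fin n → ℝ) :=
  (OrderDual.ofDual x).1

theorem finite_setOf_isFlat (A : HyperplaneArrangement n) : {x | A.IsFlat x}.Finite := by
  refine (A.finite.finite_subsets.image sInf).subset ?_
  rintro x ⟨-, T, hT, rfl⟩
  exact ⟨T, hT, rfl⟩

noncomputable instance (A : HyperplaneArrangement n) : Fintype A.IntersectionPoset :=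
  haveI : Finite {x : AffineSubspace ℝ (Fin n → ℝ) // A.IsFlat x} :=
    A.finite_setOf_isFlat.to_subtype
  haveI : Finite A.IntersectionPoset := Finite.of_equiv _ OrderDual.toDual
  Fintype.ofFinite _

open Classical in
noncomputable instance (A : HyperplaneArrangement n) : LocallyFiniteOrder A.IntersectionPoset :=
  Fintype.toLocallyFiniteOrder

/-- The least element `0̂` of the intersection poset: the whole space, as the empty intersection. -/
def zeroHat (A : HyperplaneArrangement n) : A.IntersectionPoset :=
  OrderDual.toDual ⟨⊤, ⟨0, by simp⟩, ∅, by simp, by simp⟩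

open Classical in
/-- The characteristic polynomial `χ_A(t) = ∑ μ(0̂, x) t ^ dim x`, the sum being over all flats `x`
and `μ` being the Möbius function of the intersection poset. -/
noncomputable def charPoly (A : HyperplaneArrangement n) : ℤ[X] :=
  ∑ x : A.IntersectionPoset,
    C (IncidenceAlgebra.mu ℤ A.zeroHat x) * X ^ Module.finrank ℝ x.flat.direction

end HyperplaneArrangement

/-- The linear functional `x ↦ x i - c * x j`. -/
def coordDiff {n : ℕ} (i j : Fin n) (c : ℝ) : (Fin n → ℝ) →ₗ[ℝ] ℝ :=
  LinearMap.proj i - c • LinearMap.proj j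

/-- The hyperplane `x i = 0`. -/
def coordHyperplane {n : ℕ} (i : Fin n) : AffineSubspace ℝ (Fin n → ℝ) :=
  (LinearMap.ker (LinearMap.proj i : (Fin n → ℝ) →ₗ[ℝ] ℝ)).toAffineSubspace

/-- The hyperplane `x i = c * x j`. -/
def ratioHyperplane {n : ℕ} (i j : Fin n) (c : ℝ) : AffineSubspace ℝ (Fin n → ℝ) :=
  (LinearMap.ker (coordDiff i j c)).toAffineSubspace

theorem mem_coordHyperplane {n : ℕ} (i : Fin n) (x : Fin n → ℝ) :
    x ∈ coordHyperplane i ↔ x i = 0 := by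
  simp [coordHyperplane]

theorem mem_ratioHyperplane {n : ℕ} (i j : Fin n) (c : ℝ) (x : Fin n → ℝ) :
    x ∈ ratioHyperplane i j c ↔ x i = c * x j := by
  simp [ratioHyperplane, coordDiff, sub_eq_zero]

theorem finrank_ker_add_one {n : ℕ} (f : (Fin n → ℝ) →ₗ[ℝ] ℝ) (hf : f ≠ 0) :
    Module.finrank ℝ (LinearMap.ker f) + 1 = n := by
  have h := LinearMap.finrank_range_add_finrank_ker f
  rw [LinearMap.range_eq_top.2 (LinearMap.surjective hf), finrank_top] at h
  simp at h
  omega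

/-- The arrangement `{x_i = 0 : i ∈ [n]} ∪ {x_i = a ^ k x_j : k ∈ [-m, m], 1 ≤ i < j ≤ n}`. -/
def expCatalan (n m : ℕ) (a : ℝ) : HyperplaneArrangement n where
  hyperplanes := {H | ∃ i : Fin n, H = coordHyperplane i} ∪
    {H | ∃ k ∈ Set.Icc (-(m : ℤ)) m, ∃ i j : Fin n, i < j ∧ H = ratioHyperplane i j (a ^ k)}
  finite := by
    refine Set.Finite.union ?_ ?_
    · refine (Set.finite_range (coordHyperplane (n := n))).subset ?_
      rintro H ⟨i, rfl⟩
      exact ⟨i, rfl⟩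
    · refine (((Set.finite_Icc (-(m : ℤ)) m).prod
        (Set.finite_univ (α := Fin n × Fin n))).image
          (fun p => ratioHyperplane p.2.1 p.2.2 (a ^ p.1))).subset ?_
      rintro H ⟨k, hk, i, j, -, rfl⟩
      exact ⟨(k, i, j), ⟨hk, trivial⟩, rfl⟩
  nonempty := by
    rintro H (⟨i, rfl⟩ | ⟨k, -, i, j, -, rfl⟩)
    · exact ⟨0, (mem_coordHyperplane i 0).2 rfl⟩
    · exact ⟨0, (mem_ratioHyperplane i j _ 0).2 (by simp)⟩
  codim_one := by
    rintro H (⟨i, rfl⟩ | ⟨k, -, i, j, hij, rfl⟩)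
    · rw [coordHyperplane, Submodule.toAffineSubspace_direction]
      refine finrank_ker_add_one _ fun h => ?_
      simpa using LinearMap.congr_fun h (Pi.single i 1)
    · rw [ratioHyperplane, Submodule.toAffineSubspace_direction]
      refine finrank_ker_add_one _ fun h => ?_
      simpa [coordDiff, hij.ne'] using LinearMap.congr_fun h (Pi.single i 1)

/-! ### Labeled and decorated Dyck paths -/

/-- A term of a labeled path: an up-step carrying a label, or a down-step. -/
inductive LStep where
  | up (label : ℕ) : LStep
  | down : LStep
  deriving DecidableEq

namespace LStep

/-- The label of a step, if it is an up-step. -/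
def label? : LStep → Option ℕ
  | up l => some l
  | down => none

/-- The change of height: `+m` for an up-step and `-1` for a down-step. -/
def rise (m : ℕ) : LStep → ℤ
  | up _ => m
  | down => -1

end LStep

/-- The labels of the up-steps, in the order in which they occur. -/
def stepLabels (w : List LStep) : List ℕ := w.filterMap LStep.label?

/-- The sum of the terms `+m` and `-1`, i.e. the height of the endpoint of the path. -/
def endHeight (m : ℕ) (w : List LStep) : ℤ := (w.map (LStep.rise m)).sum

/-- `w` is a labeled `m`-Dyck path with label set `S`: the up-steps are labeled bijectively by `S`,
there are `m * |S|` down-steps, and every prefix has nonnegative sum. -/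
structure IsLabeledDyckPath (m : ℕ) (S : Finset ℕ) (w : List LStep) : Prop where
  labels_nodup : (stepLabels w).Nodup
  labels_eq : (stepLabels w).toFinset = S
  count_down : w.count LStep.down = m * S.card
  prefix_nonneg : ∀ u, u <+: w → 0 ≤ endHeight m u

/-- Cut a path at each return to height `0`; `h` and `acc` are the current height and the steps
read since the last visit to the `x`-axis. -/
def cutAtReturns (m : ℕ) : ℤ → List LStep → List LStep → List (List LStep)
  | _, acc, [] => if acc = [] then [] else [acc]
  | h, acc, s :: w =>
    if h + s.rise m = 0 then (acc ++ [s]) :: cutAtReturns m 0 [] w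
    else cutAtReturns m (h + s.rise m) (acc ++ [s]) w

/-- The primitive parts of a labeled `m`-Dyck path, from left to right. -/
def primitiveParts (m : ℕ) (w : List LStep) : List (List LStep) := cutAtReturns m 0 [] w

/-- The largest label occurring in a path (`0` if there are no labels). -/
def maxLabel (w : List LStep) : ℕ := (stepLabels w).foldr max 0

/-- Group a list of primitive parts into compartments: the first compartment ends with the part
that contains the largest label, and the remaining parts are grouped in the same way. -/
def groupParts : List (List LStep) → List (List LStep)
  | [] => []
  | P :: Ps =>
    let i := (P :: Ps).findIdx fun Q => decide (maxLabel (P :: Ps).flatten ∈ stepLabels Q)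
    ((P :: Ps).take (i + 1)).flatten :: groupParts ((P :: Ps).drop (i + 1))
  termination_by parts => parts.length
  decreasing_by simp

/-- The compartments of a labeled `m`-Dyck path. -/
def compartments (m : ℕ) (w : List LStep) : List (List LStep) := groupParts (primitiveParts m w)

/-- A decorated `m`-Dyck path of size `n`: a labeled `m`-Dyck path with label set `[n]` and a chosen
point of the path (given by the number of steps before it) that lies on the `x`-axis. -/
structure DecoratedDyckPath (m n : ℕ) where
  path : List LStep
  isLabeledDyckPath : IsLabeledDyckPath m (Finset.Icc 1 n) path
  point : ℕ
  point_le : point ≤ path.length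
  point_on_axis : endHeight m (path.take point) = 0

namespace DecoratedDyckPath

variable {m n : ℕ}

/-- The labeled Dyck path before the chosen point. -/
def first (D : DecoratedDyckPath m n) : List LStep := D.path.take D.point

/-- The labeled Dyck path after the chosen point. -/
def second (D : DecoratedDyckPath m n) : List LStep := D.path.drop D.point

end DecoratedDyckPath

/-!
Both sides have a closed form: the characteristic polynomial of the arrangement is
`(X - 1) * ∏_{0 < i < n} (X - 1 - m n - i)` (`charPoly_expCatalan`), and the decorated paths,
enumerated by the number of compartments of the second path, give
`(X + 1) * ∏_{0 < i < n} (X + 1 + m n + i)` (`sum_pathPairs_X_pow`). The first is `(-1) ^ n` times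
the second at `-X`, so the coefficients agree up to sign.

*The arrangement.* By Whitney's theorem (`HyperplaneArrangement.charPoly_eq_sum`) the
characteristic polynomial is an alternating sum of `X ^ dim` over subsystems of the equations
`x i = 0` and `x i = a ^ k * x j`. Solving such a system only uses the multiplication, and the
fact that certain powers of `a` are nontrivial: `exists_parametrizes` expresses its solutions by
free parameters in every group with zero in which the ratio has large enough order. Hence, as in
the finite field method, `ℝ` can be replaced by the group with zero obtained from the cyclic group
of order `N`, where a system whose real solution space has dimension `d` has `(N + 1) ^ d`
solutions. Inclusion–exclusion (`eventually_eval_charPoly`) shows that the value at `N + 1` is the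
number of placements of `n` labeled points on a circle of length `N` at distances larger than `m`,
and this is counted by fixing one point and cutting the circle there
(`card_isCircularlySeparated`).

*The paths.* Let `raney m n t = t * ∏_{0 < i < n} (t + m n + i)`. First-step recurrences show that
`raney m n (h + 1)` counts the labeled paths from height `h` (`exists_finset_isPathFrom`), and
that `raney` is of binomial type (`sum_powerset_raney_mul_raney`). Cutting off the compartment
that contains the largest label shows that the compartment enumerator `W_S(t)` of the labeled
Dyck paths is of binomial type too (`compartmentSum_add`). The two sequences agree at `t = 1`,
hence at all natural `t`, and the decorated paths are enumerated by
`∑_U W_U(1) W_{S \ U}(t) = W_S(1 + t)`.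
-/

/-! ### Whitney's theorem for central arrangements -/

namespace HyperplaneArrangement

variable {n : ℕ} {A : HyperplaneArrangement n}

theorem IntersectionPoset.le_iff {x y : A.IntersectionPoset} : x ≤ y ↔ y.flat ≤ x.flat := Iff.rfl

theorem IntersectionPoset.flat_injective :
    Function.Injective (IntersectionPoset.flat (A := A)) := fun _ _ h => Subtype.ext h

/-- The element of the intersection poset given by a subfamily of the hyperplanes. -/
noncomputable def flatOf {ι : Type*} (h : ι → AffineSubspace ℝ (Fin n → ℝ))
    (hA : Set.range h = A.hyperplanes)
    (hne : ∀ T : Finset ι, ((T.inf h : AffineSubspace ℝ (Fin n → ℝ)) : Set (Fin n → ℝ)).Nonempty)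
    (T : Finset ι) :
    A.IntersectionPoset :=
  OrderDual.toDual ⟨T.inf h, hne T, h '' T, by rw [← hA]; exact Set.image_subset_range _ _, by
    rw [sInf_image, Finset.inf_eq_iInf]; rfl⟩

theorem flat_flatOf {ι : Type*} (h : ι → AffineSubspace ℝ (Fin n → ℝ))
    (hA : Set.range h = A.hyperplanes)
    (hne : ∀ T : Finset ι, ((T.inf h : AffineSubspace ℝ (Fin n → ℝ)) : Set (Fin n → ℝ)).Nonempty)
    (T : Finset ι) :
    (flatOf h hA hne T).flat = T.inf h := rfl

open Classical in
/-- The Möbius function as an alternating sum over the subfamilies of hyperplanes that cut out a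
given flat. The family `h` may repeat hyperplanes. -/
theorem mu_zeroHat_eq_sum {ι : Type*} [Fintype ι] (h : ι → AffineSubspace ℝ (Fin n → ℝ))
    (hA : Set.range h = A.hyperplanes)
    (hne : ∀ T : Finset ι, ((T.inf h : AffineSubspace ℝ (Fin n → ℝ)) : Set (Fin n → ℝ)).Nonempty)
    (x : A.IntersectionPoset) :
    IncidenceAlgebra.mu ℤ A.zeroHat x =
      ∑ T : Finset ι with flatOf h hA hne T = x, (-1 : ℤ) ^ T.card := by
  have zero_le : ∀ x : A.IntersectionPoset, A.zeroHat ≤ x := fun x =>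
    IntersectionPoset.le_iff.2 le_top
  -- Summed over the interval below `x`, the right-hand side runs over the subfamilies of the
  -- hyperplanes containing `x`, and cancels unless there are none.
  have key : ∀ x : A.IntersectionPoset,
      ∑ y ∈ Finset.Icc A.zeroHat x, ∑ T : Finset ι with flatOf h hA hne T = y, (-1 : ℤ) ^ T.card
        = if A.zeroHat = x then 1 else 0 := by
    intro x
    have h1 : ∑ y ∈ Finset.Icc A.zeroHat x,
        ∑ T : Finset ι with flatOf h hA hne T = y, (-1 : ℤ) ^ T.card =
        ∑ T ∈ (Finset.univ.filter fun c => x.flat ≤ h c).powerset, (-1 : ℤ) ^ T.card := by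
      rw [← Finset.sum_fiberwise_of_maps_to (t := Finset.Icc A.zeroHat x)
        (g := flatOf h hA hne)]
      · refine Finset.sum_congr rfl fun y hy => Finset.sum_congr ?_ fun _ _ => rfl
        ext T
        simp only [Finset.mem_filter, Finset.mem_univ, true_and, Finset.mem_powerset]
        refine ⟨?_, fun h => h.2⟩
        rintro rfl
        refine ⟨fun c hc => ?_, rfl⟩
        have := IntersectionPoset.le_iff.1 (Finset.mem_Icc.1 hy).2
        rw [flat_flatOf, Finset.le_inf_iff] at this
        simpa using this c hc
      · intro T hT
        refine Finset.mem_Icc.2 ⟨zero_le _, IntersectionPoset.le_iff.2 ?_⟩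
        rw [flat_flatOf, Finset.le_inf_iff]
        intro c hc
        simpa using Finset.mem_powerset.1 hT hc
    rw [h1, Finset.sum_powerset_neg_one_pow_card]
    refine if_congr ?_ rfl rfl
    constructor
    · intro he
      obtain ⟨-, T, hT, hx⟩ := (OrderDual.ofDual x).2
      have : T = ∅ := by
        by_contra hT0
        obtain ⟨H, hH⟩ := Set.nonempty_iff_ne_empty.2 hT0
        obtain ⟨c, rfl⟩ : H ∈ Set.range h := hA ▸ hT hH
        have : c ∈ Finset.univ.filter fun c => x.flat ≤ h c := by
          simpa [IntersectionPoset.flat, hx] using sInf_le hH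
        simp [he] at this
      apply IntersectionPoset.flat_injective
      change ⊤ = x.flat
      rw [IntersectionPoset.flat, hx, this, sInf_empty]
    · rintro rfl
      refine Finset.filter_eq_empty_iff.2 fun c _ hc => ?_
      have hH : h c ∈ A.hyperplanes := hA ▸ Set.mem_range_self c
      have htop : h c = ⊤ := top_le_iff.1 hc
      have := A.codim_one _ hH
      rw [htop, AffineSubspace.direction_top, finrank_top] at this
      simp at this
  induction hk : (Finset.Ico A.zeroHat x).card using Nat.strong_induction_on generalizing x with
  | _ k ih =>
    have e1 := key x
    rw [← IncidenceAlgebra.sum_Icc_mu_right (𝕜 := ℤ) A.zeroHat x,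
      ← Finset.Ico_insert_right (zero_le x), Finset.sum_insert Finset.right_notMem_Ico,
      Finset.sum_insert Finset.right_notMem_Ico] at e1
    have e2 : ∑ y ∈ Finset.Ico A.zeroHat x,
        ∑ T : Finset ι with flatOf h hA hne T = y, (-1 : ℤ) ^ T.card =
        ∑ y ∈ Finset.Ico A.zeroHat x, IncidenceAlgebra.mu ℤ A.zeroHat y := by
      refine Finset.sum_congr rfl fun y hy => (ih _ ?_ y rfl).symm
      rw [← hk]
      refine Finset.card_lt_card ((Finset.ssubset_iff_of_subset ?_).2 ⟨y, hy, by simp⟩)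
      exact Finset.Ico_subset_Ico_right (Finset.mem_Ico.1 hy).2.le
    rw [e2] at e1
    exact (add_right_cancel e1).symm

/-- Whitney's theorem, for an arrangement all of whose subfamilies have a common point. The family
`h` may repeat hyperplanes. -/
theorem charPoly_eq_sum {ι : Type*} [Fintype ι] (h : ι → AffineSubspace ℝ (Fin n → ℝ))
    (hA : Set.range h = A.hyperplanes)
    (hne : ∀ T : Finset ι, ((T.inf h : AffineSubspace ℝ (Fin n → ℝ)) : Set (Fin n → ℝ)).Nonempty) :
    A.charPoly = ∑ T : Finset ι, C ((-1 : ℤ) ^ T.card) *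
      X ^ Module.finrank ℝ (T.inf h).direction := by
  classical
  rw [charPoly, ← Finset.sum_fiberwise_of_maps_to (t := Finset.univ)
    (g := flatOf h hA hne) (fun _ _ => Finset.mem_univ _)]
  refine Finset.sum_congr rfl fun x _ => ?_
  have := mu_zeroHat_eq_sum h hA hne x
  convert congrArg (fun z => C z * X ^ Module.finrank ℝ x.flat.direction) this using 1
  rw [map_sum, Finset.sum_mul]
  refine Finset.sum_congr rfl fun T hT => ?_
  rw [← (Finset.mem_filter.1 hT).2, flat_flatOf]

end HyperplaneArrangement

/-! ### Systems of multiplicative equations over a group with zero -/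

/-- An index for the equations of the arrangement: `inl i` stands for `x i = 0`, and
`inr (i, j, k)` for `x i = g ^ k * x j`. -/
abbrev Equation (n : ℕ) : Type := Fin n ⊕ (Fin n × Fin n × ℤ)

/-- The point `x` with coordinates in a group with zero satisfies the given equation, the ratio
being taken to be `g`. -/
def Equation.Holds {n : ℕ} {G : Type} [CommGroupWithZero G] (g : G) (x : Fin n → G) :
    Equation n → Prop
  | .inl i => x i = 0
  | .inr (i, j, k) => x i = g ^ k * x j

/-- The value of the parametrized coordinate `none ↦ 0`, `some (e, c) ↦ g ^ c * y e`. -/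
def monomialValue {D G : Type} [CommGroupWithZero G] (g : G) (y : D → G) : Option (D × ℤ) → G
  | none => 0
  | some (e, c) => g ^ c * y e

/-- Substitution of parametrized coordinates into a parametrized coordinate. -/
def substMonomial {D D' : Type} (ψ : D → Option (D' × ℤ)) : Option (D × ℤ) → Option (D' × ℤ)
  | none => none
  | some (e, c) => (ψ e).map fun p => (p.1, c + p.2)

theorem monomialValue_substMonomial {D D' G : Type} [CommGroupWithZero G] {g : G} (hg : g ≠ 0)
    (y : D' → G) (ψ : D → Option (D' × ℤ)) (o : Option (D × ℤ)) :
    monomialValue g y (substMonomial ψ o) =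
      monomialValue g (fun e => monomialValue g y (ψ e)) o := by
  rcases o with _ | ⟨e, c⟩
  · rfl
  · rcases h : ψ e with _ | ⟨e', c'⟩ <;>
      simp [substMonomial, monomialValue, h, zpow_add₀ hg, mul_assoc]

/-- A parametrization `φ` of the solutions of a system `T`, valid over every group with zero in
which the powers of the ratio up to exponent `B` are nontrivial. -/
structure Parametrizes {n : ℕ} {D : Type} (φ : Fin n → Option (D × ℤ)) (T : Finset (Equation n))
    (B : ℕ) : Prop where
  surj : ∀ e, ∃ i c, φ i = some (e, c)
  iff : ∀ {G : Type} [CommGroupWithZero G] (g : G), g ≠ 0 →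
    (∀ k : ℤ, k ≠ 0 → k.natAbs ≤ B → g ^ k ≠ 1) → ∀ x : Fin n → G,
    (∀ c ∈ T, c.Holds g x) ↔ ∃ y : D → G, ∀ i, x i = monomialValue g y (φ i)

/-- Imposing one more equation that amounts to a substitution of the parameters. -/
theorem Parametrizes.insert {n : ℕ} {D D' : Type} {φ : Fin n → Option (D × ℤ)}
    {T : Finset (Equation n)} {B B' : ℕ} (h : Parametrizes φ T B) (c : Equation n) (hB : B ≤ B')
    (ψ : D → Option (D' × ℤ)) (hψ : ∀ e', ∃ e k, ψ e = some (e', k))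
    (hc : ∀ {G : Type} [CommGroupWithZero G] (g : G), g ≠ 0 →
      (∀ k : ℤ, k ≠ 0 → k.natAbs ≤ B' → g ^ k ≠ 1) → ∀ y : D → G,
      c.Holds g (fun i => monomialValue g y (φ i)) ↔
        ∃ y' : D' → G, ∀ e, y e = monomialValue g y' (ψ e)) :
    Parametrizes (fun i => substMonomial ψ (φ i)) (insert c T) B' where
  surj e' := by
    obtain ⟨e, k, hk⟩ := hψ e'
    obtain ⟨i, l, hl⟩ := h.surj e
    exact ⟨i, l + k, by simp [hl, substMonomial, hk]⟩
  iff g hg hB'' x := by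
    rw [Finset.forall_mem_insert, h.iff g hg fun k h0 hk => hB'' k h0 (hk.trans hB)]
    constructor
    · rintro ⟨hx, y, hy⟩
      rw [show x = fun i => monomialValue g y (φ i) from funext hy, hc g hg hB''] at hx
      obtain ⟨y', hy'⟩ := hx
      refine ⟨y', fun i => ?_⟩
      rw [hy, monomialValue_substMonomial hg, show y = _ from funext hy']
    · rintro ⟨y', hy'⟩
      have hx : x = fun i => monomialValue g (fun e => monomialValue g y' (ψ e)) (φ i) :=
        funext fun i => by rw [hy', monomialValue_substMonomial hg]
      refine ⟨?_, _, fun i => congrFun hx i⟩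
      rw [hx, hc g hg hB'']
      exact ⟨y', fun _ => rfl⟩

open Classical in
/-- Setting the parameter `e₀` to zero. -/
noncomputable def killParam {D : Type} (e₀ : D) (e : D) : Option ({e // e ≠ e₀} × ℤ) :=
  if h : e = e₀ then none else some (⟨e, h⟩, 0)

theorem killParam_surj {D : Type} (e₀ : D) (e' : {e // e ≠ e₀}) :
    ∃ e k, killParam e₀ e = some (e', k) := ⟨e', 0, by simp [killParam, e'.2]⟩

theorem exists_killParam_iff {D G : Type} [CommGroupWithZero G] (g : G) (e₀ : D) (y : D → G) :
    (∃ y' : {e // e ≠ e₀} → G, ∀ e, y e = monomialValue g y' (killParam e₀ e)) ↔ y e₀ = 0 := by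
  constructor
  · rintro ⟨y', h⟩
    simp [h e₀, killParam, monomialValue]
  · intro h
    refine ⟨fun e => y e, fun e => ?_⟩
    by_cases he : e = e₀
    · subst he; simp [killParam, monomialValue, h]
    · simp [killParam, monomialValue, he]

open Classical in
/-- Replacing the parameter `e₀` by `g ^ k` times the parameter `e₁`. -/
noncomputable def mergeParam {D : Type} (e₀ e₁ : D) (h : e₁ ≠ e₀) (k : ℤ) (e : D) :
    Option ({e // e ≠ e₀} × ℤ) :=
  if h' : e = e₀ then some (⟨e₁, h⟩, k) else some (⟨e, h'⟩, 0)

theorem mergeParam_surj {D : Type} (e₀ e₁ : D) (h : e₁ ≠ e₀) (k : ℤ) (e' : {e // e ≠ e₀}) :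
    ∃ e l, mergeParam e₀ e₁ h k e = some (e', l) := ⟨e', 0, by simp [mergeParam, e'.2]⟩

theorem exists_mergeParam_iff {D G : Type} [CommGroupWithZero G] (g : G) (e₀ e₁ : D) (h : e₁ ≠ e₀)
    (k : ℤ) (y : D → G) :
    (∃ y' : {e // e ≠ e₀} → G, ∀ e, y e = monomialValue g y' (mergeParam e₀ e₁ h k e)) ↔
      y e₀ = g ^ k * y e₁ := by
  constructor
  · rintro ⟨y', h'⟩
    simp [h' e₀, h' e₁, mergeParam, monomialValue, h]
  · intro h'
    refine ⟨fun e => y e, fun e => ?_⟩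
    by_cases he : e = e₀
    · subst he; simp [mergeParam, monomialValue, h']
    · simp [mergeParam, monomialValue, he]

/-- Every system of equations has a parametrization: its solutions are obtained by choosing a
value for each of finitely many independent parameters. -/
theorem exists_parametrizes {n : ℕ} (T : Finset (Equation n)) :
    ∃ (D : Type) (_ : Finite D) (φ : Fin n → Option (D × ℤ)) (B : ℕ), Parametrizes φ T B := by
  classical
  induction T using Finset.induction_on with
  | empty =>
    exact ⟨Fin n, inferInstance, fun i => some (i, 0), 0, fun e => ⟨e, 0, rfl⟩,
      fun g hg _ x => by simpa [monomialValue] using ⟨x, fun _ => rfl⟩⟩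
  | insert c T _ ih =>
    obtain ⟨D, hD, φ, B, h⟩ := ih
    have trivialCase : (∀ {G : Type} [CommGroupWithZero G] (g : G), g ≠ 0 → ∀ y : D → G,
        c.Holds g (fun i => monomialValue g y (φ i))) →
        ∃ (D : Type) (_ : Finite D) (φ : Fin n → Option (D × ℤ)) (B : ℕ),
          Parametrizes φ (insert c T) B := fun hc =>
      ⟨D, hD, _, B, h.insert c le_rfl (fun e => some (e, 0)) (fun e => ⟨e, 0, rfl⟩)
        fun g hg _ y => iff_of_true (hc g hg y) ⟨y, fun e => by simp [monomialValue]⟩⟩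
    have killCase : ∀ (e₀ : D) (B' : ℕ), (∀ {G : Type} [CommGroupWithZero G] (g : G), g ≠ 0 →
        (∀ k : ℤ, k ≠ 0 → k.natAbs ≤ B' → g ^ k ≠ 1) → ∀ y : D → G,
        (c.Holds g (fun i => monomialValue g y (φ i)) ↔ y e₀ = 0)) →
        ∃ (D : Type) (_ : Finite D) (φ : Fin n → Option (D × ℤ)) (B : ℕ),
          Parametrizes φ (insert c T) B := fun e₀ B' hc =>
      ⟨_, inferInstance, _, max B B', h.insert c (le_max_left _ _) (killParam e₀)
        (killParam_surj e₀) fun g hg hB y => (hc g hg (fun k h0 hk => hB k h0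
          (hk.trans (le_max_right _ _))) y).trans (exists_killParam_iff g e₀ y).symm⟩
    rcases c with i | ⟨i, j, k⟩
    · rcases hi : φ i with _ | ⟨e, c⟩
      · exact trivialCase fun g _ y => by simp [Equation.Holds, hi, monomialValue]
      · exact killCase e 0 fun g hg _ y => by
          simp [Equation.Holds, hi, monomialValue, zpow_ne_zero, hg]
    · rcases hi : φ i with _ | ⟨e, c⟩ <;> rcases hj : φ j with _ | ⟨e', c'⟩
      · exact trivialCase fun g _ y => by simp [Equation.Holds, hi, hj, monomialValue]
      · exact killCase e' 0 fun g hg _ y => by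
          simp [Equation.Holds, hi, hj, monomialValue, zpow_ne_zero, hg, eq_comm]
      · exact killCase e 0 fun g hg _ y => by
          simp [Equation.Holds, hi, hj, monomialValue, zpow_ne_zero, hg]
      · have rearrange : ∀ {G : Type} [CommGroupWithZero G] (g : G), g ≠ 0 → ∀ y : D → G,
            (Equation.Holds g (fun i => monomialValue g y (φ i)) (.inr (i, j, k)) ↔
              y e = g ^ (k + c' - c) * y e') := by
          intro G _ g hg y
          have hc : g ^ c ≠ 0 := zpow_ne_zero _ hg
          simp only [Equation.Holds, hi, hj, monomialValue]
          rw [← mul_right_inj' hc (b := y e), ← mul_assoc, ← mul_assoc, ← zpow_add₀ hg,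
            ← zpow_add₀ hg, add_sub_cancel]
        by_cases he : e' = e
        · subst he
          by_cases hk : k + c' - c = 0
          · exact trivialCase fun g hg y => by rw [rearrange g hg, hk]; simp
          -- A cycle of the equations with nontrivial gain forces the parameter to vanish.
          · refine killCase e' (k + c' - c).natAbs fun g hg hB y => ?_
            rw [rearrange g hg, eq_comm]
            exact ⟨fun h => by
              by_contra h0
              exact hB _ hk le_rfl (mul_eq_right₀ h0 |>.1 h), fun h => by simp [h]⟩
        · exact ⟨_, inferInstance, _, B, h.insert _ le_rfl (mergeParam e e' he (k + c' - c))
            (mergeParam_surj _ _ _ _) fun g hg _ y =>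
              (rearrange g hg y).trans (exists_mergeParam_iff g e e' he _ y).symm⟩

theorem Parametrizes.injective {n : ℕ} {D : Type} {φ : Fin n → Option (D × ℤ)}
    {T : Finset (Equation n)} {B : ℕ} (h : Parametrizes φ T B) {G : Type} [CommGroupWithZero G]
    {g : G} (hg : g ≠ 0) :
    Function.Injective fun (y : D → G) i => monomialValue g y (φ i) := by
  intro y y' hy
  ext e
  obtain ⟨i, c, hi⟩ := h.surj e
  have := congrFun hy i
  simpa [hi, monomialValue, zpow_ne_zero, hg] using this

theorem Parametrizes.card_solutions {n : ℕ} {D : Type} [Finite D] {φ : Fin n → Option (D × ℤ)}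
    {T : Finset (Equation n)} {B : ℕ} (h : Parametrizes φ T B) {G : Type} [CommGroupWithZero G]
    {g : G} (hg : g ≠ 0) (hB : ∀ k : ℤ, k ≠ 0 → k.natAbs ≤ B → g ^ k ≠ 1) :
    Nat.card {x : Fin n → G // ∀ c ∈ T, c.Holds g x} = Nat.card G ^ Nat.card D := by
  rw [← Nat.card_fun]
  refine Nat.card_congr ((Equiv.ofInjective _ (h.injective hg)).trans
    (Equiv.subtypeEquivRight fun x => ?_)).symm
  rw [h.iff g hg hB]
  exact ⟨fun ⟨y, hy⟩ => ⟨y, fun i => (congrFun hy i).symm⟩,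
    fun ⟨y, hy⟩ => ⟨y, funext fun i => (hy i).symm⟩⟩

theorem Parametrizes.finrank_solutions {n : ℕ} {D : Type} [Finite D] {φ : Fin n → Option (D × ℤ)}
    {T : Finset (Equation n)} {B : ℕ} (h : Parametrizes φ T B) {g : ℝ} (hg : g ≠ 0)
    (hB : ∀ k : ℤ, k ≠ 0 → k.natAbs ≤ B → g ^ k ≠ 1) (L : AffineSubspace ℝ (Fin n → ℝ))
    (hL : ∀ x, x ∈ L ↔ ∀ c ∈ T, c.Holds g x) :
    Module.finrank ℝ L.direction = Nat.card D := by
  have := Fintype.ofFinite D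
  let f : (D → ℝ) →ₗ[ℝ] (Fin n → ℝ) :=
    { toFun := fun y i => monomialValue g y (φ i)
      map_add' := fun y y' => by
        ext i; rcases hi : φ i with _ | ⟨e, c⟩ <;> simp [hi, monomialValue, mul_add]
      map_smul' := fun r y => by
        ext i; rcases hi : φ i with _ | ⟨e, c⟩ <;> simp [hi, monomialValue, mul_left_comm] }
  have hLf : L = (LinearMap.range f).toAffineSubspace := by
    ext x
    rw [hL, h.iff g hg hB, Submodule.mem_toAffineSubspace]
    exact ⟨fun ⟨y, hy⟩ => ⟨y, funext fun i => (hy i).symm⟩,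
      fun ⟨y, hy⟩ => ⟨y, fun i => (congrFun hy i).symm⟩⟩
  rw [hLf, Submodule.toAffineSubspace_direction, LinearMap.finrank_range_of_inj (h.injective hg)]
  simp

/-! ### Evaluating the characteristic polynomial by counting points -/

/-- The equations of the hyperplanes of the arrangement. -/
noncomputable def arrangementEquations (n m : ℕ) : Finset (Equation n) :=
  Finset.univ.disjSum ((Finset.univ ×ˢ Finset.univ ×ˢ Finset.Icc (-(m : ℤ)) m).filter
    fun p => p.1 < p.2.1)

theorem inr_mem_arrangementEquations {n m : ℕ} {i j : Fin n} {k : ℤ} :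
    Sum.inr (i, j, k) ∈ arrangementEquations n m ↔ i < j ∧ -(m : ℤ) ≤ k ∧ k ≤ m := by
  simp [arrangementEquations, and_comm]

/-- The hyperplane defined by an equation, for the real ratio `a`. -/
noncomputable def Equation.hyperplane {n : ℕ} (a : ℝ) : Equation n → AffineSubspace ℝ (Fin n → ℝ)
  | .inl i => coordHyperplane i
  | .inr (i, j, k) => ratioHyperplane i j (a ^ k)

theorem Equation.mem_hyperplane {n : ℕ} (a : ℝ) (c : Equation n) (x : Fin n → ℝ) :
    x ∈ c.hyperplane a ↔ c.Holds a x := by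
  rcases c with i | ⟨i, j, k⟩
  · exact mem_coordHyperplane i x
  · exact mem_ratioHyperplane i j _ x

theorem range_hyperplane (n m : ℕ) (a : ℝ) :
    Set.range (fun c : arrangementEquations n m => c.1.hyperplane a) =
      (expCatalan n m a).hyperplanes := by
  ext H
  constructor
  · rintro ⟨⟨i | ⟨i, j, k⟩, hc⟩, rfl⟩
    · exact Or.inl ⟨i, rfl⟩
    · obtain ⟨hij, hk⟩ := inr_mem_arrangementEquations.1 hc
      exact Or.inr ⟨k, hk, i, j, hij, rfl⟩
  · rintro (⟨i, rfl⟩ | ⟨k, hk, i, j, hij, rfl⟩)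
    · exact ⟨⟨.inl i, by simp [arrangementEquations]⟩, rfl⟩
    · exact ⟨⟨.inr (i, j, k), inr_mem_arrangementEquations.2 ⟨hij, hk⟩⟩, rfl⟩

theorem AffineSubspace.mem_finset_inf {ι V : Type*} [AddCommGroup V] [Module ℝ V]
    (T : Finset ι) (h : ι → AffineSubspace ℝ V) (x : V) :
    x ∈ T.inf h ↔ ∀ c ∈ T, x ∈ h c := by
  classical
  induction T using Finset.induction_on with
  | empty => simp
  | insert c T _ ih =>
    rw [Finset.inf_insert, Finset.forall_mem_insert, ← ih]
    exact AffineSubspace.mem_inf_iff _ _ _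

theorem sum_neg_one_pow_card_mul_card {ι α : Type*} [Fintype ι] [Finite α] (P : ι → α → Prop) :
    ∑ T : Finset ι, (-1 : ℤ) ^ T.card * Nat.card {x // ∀ c ∈ T, P c x} =
      Nat.card {x // ∀ c, ¬ P c x} := by
  classical
  have := Fintype.ofFinite α
  simp only [Nat.card_eq_fintype_card, Fintype.card_subtype, Finset.card_filter, Nat.cast_sum,
    Nat.cast_ite, Nat.cast_one, Nat.cast_zero, Finset.mul_sum, mul_ite, mul_one, mul_zero]
  rw [Finset.sum_comm]
  refine Finset.sum_congr rfl fun x _ => ?_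
  have : ∀ T : Finset ι, (∀ c ∈ T, P c x) ↔ T ∈ (Finset.univ.filter fun c => P c x).powerset := by
    intro T
    simp [Finset.subset_iff]
  simp only [this]
  rw [← Finset.sum_filter, Finset.filter_mem_eq_inter, Finset.univ_inter,
    Finset.sum_powerset_neg_one_pow_card]
  simp [Finset.filter_eq_empty_iff]

open WithZero in
theorem exp_one_zpow_ne_one {N : ℕ} {k : ℤ} (hk : k ≠ 0) (hN : k.natAbs < N) :
    (exp (1 : ZMod N)) ^ k ≠ 1 := by
  rw [← exp_zsmul, Ne, exp_eq_one, zsmul_one, ZMod.intCast_zmod_eq_zero_iff_dvd]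
  intro h
  exact hk (Int.eq_zero_of_abs_lt_dvd h (by rw [Int.abs_eq_natAbs]; exact_mod_cast hN))

theorem natCard_withZero_zmod (N : ℕ) [NeZero N] :
    Nat.card (WithZero (Multiplicative (ZMod N))) = N + 1 := by
  have e : WithZero (Multiplicative (ZMod N)) = Option (ZMod N) := rfl
  rw [e, Finite.card_option, Nat.card_zmod]

instance (N : ℕ) [NeZero N] : Finite (WithZero (Multiplicative (ZMod N))) :=
  inferInstanceAs (Finite (Option (ZMod N)))

open WithZero in
/-- For large `N`, the characteristic polynomial at `N + 1` counts the points off all the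
hyperplanes over the group with zero obtained from the cyclic group of order `N`. -/
theorem eventually_eval_charPoly (n m : ℕ) {a : ℝ} (ha : 1 < a) :
    ∀ᶠ N : ℕ in Filter.atTop, (expCatalan n m a).charPoly.eval ((N : ℤ) + 1) =
      Nat.card {x : Fin n → WithZero (Multiplicative (ZMod N)) //
        ∀ c ∈ arrangementEquations n m, ¬ c.Holds (exp (1 : ZMod N)) x} := by
  classical
  let h : arrangementEquations n m → AffineSubspace ℝ (Fin n → ℝ) := fun c => c.1.hyperplane a
  have hmem : ∀ (T : Finset (arrangementEquations n m)) x,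
      x ∈ T.inf h ↔ ∀ c ∈ T, c.1.Holds a x := fun T x => by
    simp only [AffineSubspace.mem_finset_inf, h, Equation.mem_hyperplane]
  have hne : ∀ T : Finset (arrangementEquations n m),
      ((T.inf h : AffineSubspace ℝ (Fin n → ℝ)) : Set (Fin n → ℝ)).Nonempty := fun T =>
    ⟨0, (hmem T 0).2 fun c _ => by rcases c with ⟨i | ⟨i, j, k⟩, _⟩ <;> simp [Equation.Holds]⟩
  have ha0 : a ≠ 0 := by positivity
  have key : ∀ᶠ N : ℕ in Filter.atTop, ∀ T : Finset (arrangementEquations n m),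
      ((N : ℤ) + 1) ^ Module.finrank ℝ (T.inf h).direction =
        Nat.card {x : Fin n → WithZero (Multiplicative (ZMod N)) //
          ∀ c ∈ T, c.1.Holds (exp (1 : ZMod N)) x} := by
    refine Filter.eventually_all.2 fun T => ?_
    obtain ⟨D, hD, φ, B, hφ⟩ := exists_parametrizes (T.map (Function.Embedding.subtype _))
    filter_upwards [Filter.eventually_gt_atTop B] with N hN
    have : NeZero N := ⟨by omega⟩
    rw [hφ.finrank_solutions ha0]
    · have := hφ.card_solutions (exp_ne_zero (a := (1 : ZMod N)))
        (fun k hk hkB => exp_one_zpow_ne_one hk (by omega))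
      rw [natCard_withZero_zmod] at this
      have e := congrArg (Nat.cast (R := ℤ)) this
      push_cast at e
      rw [← e]
      simp
    · intro k hk _
      rw [Ne, zpow_eq_one_iff_right₀ (by positivity) ha.ne']
      exact hk
    · intro x
      rw [hmem]
      simp
  filter_upwards [key, Filter.eventually_gt_atTop 0] with N hN hN0
  have : NeZero N := ⟨by omega⟩
  rw [HyperplaneArrangement.charPoly_eq_sum h (range_hyperplane n m a) hne, eval_finsetSum]
  have := sum_neg_one_pow_card_mul_card
    fun (c : arrangementEquations n m) (x : Fin n → WithZero (Multiplicative (ZMod N))) =>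
      c.1.Holds (exp (1 : ZMod N)) x
  simp only [Subtype.forall] at this
  rw [← this]
  refine Finset.sum_congr rfl fun T _ => ?_
  simp only [eval_mul, eval_C, eval_pow, eval_X]
  rw [hN T]
  simp

/-! ### Counting separated placements on a line and on a circle -/

/-- Placements of `k` labeled points on `{0, …, M - 1}` at distances larger than `m`. -/
def IsSeparated (m M : ℕ) {k : ℕ} (y : Fin k → ℕ) : Prop :=
  (∀ i, y i < M) ∧ ∀ i j, i ≠ j → y i + m < y j ∨ y j + m < y i

theorem isSeparated_insertNth {m M k : ℕ} (j : Fin (k + 1)) (y : Fin k → ℕ) :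
    IsSeparated m (M + 1) (j.insertNth (α := fun _ => ℕ) M y) ↔ IsSeparated m (M - m) y := by
  constructor
  · rintro ⟨h1, h2⟩
    refine ⟨fun i => ?_, fun i i' hi => ?_⟩
    · have e1 := h1 (j.succAbove i)
      have e2 := h2 j (j.succAbove i) (Fin.succAbove_ne j i).symm
      simp only [Fin.insertNth_apply_succAbove, Fin.insertNth_apply_same] at e1 e2
      omega
    · have e2 := h2 (j.succAbove i) (j.succAbove i') (by simpa using hi)
      simpa only [Fin.insertNth_apply_succAbove] using e2
  · rintro ⟨h1, h2⟩
    refine ⟨(Fin.forall_iff_succAbove j).2 ⟨by simp, fun i => ?_⟩,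
      (Fin.forall_iff_succAbove j).2 ⟨(Fin.forall_iff_succAbove j).2 ⟨by simp, fun i _ => ?_⟩,
        fun i => (Fin.forall_iff_succAbove j).2 ⟨fun _ => ?_, fun i' hi => ?_⟩⟩⟩ <;>
      simp only [Fin.insertNth_apply_succAbove, Fin.insertNth_apply_same]
    · have := h1 i; omega
    · have := h1 i; omega
    · have := h1 i; omega
    · exact h2 i i' (by rintro rfl; exact hi rfl)

open Classical in
/-- The finite set of separated placements. -/
noncomputable def separated (m M k : ℕ) : Finset (Fin k → ℕ) :=
  (Fintype.piFinset fun _ => Finset.range M).filter (IsSeparated m M)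

theorem mem_separated {m M k : ℕ} {y : Fin k → ℕ} :
    y ∈ separated m M k ↔ IsSeparated m M y := by
  simp only [separated, Finset.mem_filter, Fintype.mem_piFinset, Finset.mem_range,
    and_iff_right_iff_imp]
  exact fun h => h.1

/-- Either the last place is free, or exactly one of the `k + 1` points occupies it. -/
theorem card_separated_succ_succ (m M k : ℕ) :
    (separated m (M + 1) (k + 1)).card =
      (separated m M (k + 1)).card + (k + 1) * (separated m (M - m) k).card := by
  classical
  have hsplit : separated m (M + 1) (k + 1) = separated m M (k + 1) ∪
      Finset.univ.biUnion fun j : Fin (k + 1) =>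
        (separated m (M - m) k).image (j.insertNth (α := fun _ => ℕ) M) := by
    ext y
    simp only [Finset.mem_union, Finset.mem_biUnion, Finset.mem_univ, true_and, Finset.mem_image,
      mem_separated]
    constructor
    · intro hy
      by_cases h : ∃ j, y j = M
      · obtain ⟨j, hj⟩ := h
        have hy' : j.insertNth (α := fun _ => ℕ) M (j.removeNth y) = y := by
          rw [← hj, Fin.insertNth_self_removeNth]
        refine Or.inr ⟨j, j.removeNth y, ?_, hy'⟩
        rwa [← isSeparated_insertNth j, hy']
      · refine Or.inl ⟨fun i => ?_, hy.2⟩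
        have := hy.1 i
        have : y i ≠ M := fun e => h ⟨i, e⟩
        omega
    · rintro (hy | ⟨j, y', hy', rfl⟩)
      · exact ⟨fun i => (hy.1 i).trans (Nat.lt_succ_self M), hy.2⟩
      · exact (isSeparated_insertNth j y').2 hy'
  rw [hsplit, Finset.card_union_of_disjoint, Finset.card_biUnion]
  · simp only [Finset.card_image_of_injective _ (Fin.insertNth_right_injective _)]
    simp
  · intro j _ j' _ hj
    refine Finset.disjoint_left.2 fun y hy hy' => ?_
    obtain ⟨u, hu, rfl⟩ := Finset.mem_image.1 hy
    obtain ⟨u', -, e⟩ := Finset.mem_image.1 hy'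
    have h1 := ((isSeparated_insertNth j u).2 (mem_separated.1 hu)).2 j j' hj
    have h2 := congrFun e j'
    simp only [Fin.insertNth_apply_same] at h1 h2
    omega
  · refine Finset.disjoint_left.2 fun y hy hy' => ?_
    obtain ⟨j, -, hj⟩ := Finset.mem_biUnion.1 hy'
    obtain ⟨u, -, rfl⟩ := Finset.mem_image.1 hj
    simpa using (mem_separated.1 hy).1 j

theorem Nat.succ_descFactorial_succ_eq_add (a k : ℕ) :
    (a + 1).descFactorial (k + 1) = a.descFactorial (k + 1) + (k + 1) * a.descFactorial k := by
  rw [Nat.succ_descFactorial_succ, Nat.descFactorial_succ, ← add_mul]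
  rcases le_or_gt k a with h | h
  · congr 1; omega
  · simp [Nat.descFactorial_of_lt h]

theorem card_separated (m M k : ℕ) :
    (separated m M k).card = (M + m - m * k).descFactorial k := by
  induction M using Nat.strong_induction_on generalizing k with
  | _ M ih =>
    rcases k with _ | k
    · rw [Nat.descFactorial_zero, Finset.card_eq_one]
      exact ⟨0, by ext y; simp [mem_separated, IsSeparated, Subsingleton.elim y 0]⟩
    rcases M with _ | M
    · have : separated m 0 (k + 1) = ∅ := by
        ext y; simpa [mem_separated] using fun h : IsSeparated m 0 y => absurd (h.1 0) (by simp)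
      rw [this, show 0 + m - m * (k + 1) = 0 by rw [mul_add]; omega]
      simp
    rw [card_separated_succ_succ, ih M (by omega), ih (M - m) (by omega),
      show M + 1 + m - m * (k + 1) = M + 1 - m * k by rw [mul_add]; omega,
      show M + m - m * (k + 1) = M - m * k by rw [mul_add]; omega]
    rcases le_or_gt (m * k) M with h | h
    · rw [show M + 1 - m * k = M - m * k + 1 by omega, Nat.succ_descFactorial_succ_eq_add]
      rcases k with _ | k
      · simp
      · rw [show M - m + m - m * (k + 1) = M - m * (k + 1) by rw [mul_add] at h ⊢; omega]
    · have hk : 0 < k := Nat.pos_of_ne_zero (by rintro rfl; simp at h)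
      have hm : m ≤ m * k := Nat.le_mul_of_pos_right m hk
      obtain ⟨k, rfl⟩ := Nat.exists_eq_add_one_of_ne_zero hk.ne'
      rw [show M + 1 - m * (k + 1) = 0 by omega, show M - m * (k + 1) = 0 by omega,
        show M - m + m - m * (k + 1) = 0 by omega]
      simp

/-- Placements of labeled points on a circle of length `N` at distances larger than `m`. -/
def IsCircularlySeparated (m : ℕ) {N n : ℕ} (z : Fin n → ZMod N) : Prop :=
  ∀ i j, i < j → ∀ k : ℤ, -(m : ℤ) ≤ k → k ≤ m → z i ≠ k + z j

open WithZero in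
theorem forall_not_holds_exp_iff {n m N : ℕ} (x : Fin n → WithZero (Multiplicative (ZMod N))) :
    (∀ c ∈ arrangementEquations n m, ¬ c.Holds (exp (1 : ZMod N)) x) ↔
      ∃ z : Fin n → ZMod N, IsCircularlySeparated m z ∧ (fun i => exp (z i)) = x := by
  have hz : ∀ z : Fin n → ZMod N, ∀ i j (k : ℤ),
      exp (z i) = exp (1 : ZMod N) ^ k * exp (z j) ↔ z i = k + z j := fun z i j k => by
    rw [← exp_zsmul, ← exp_add, exp_inj, zsmul_one]
  constructor
  · intro h
    have h0 : ∀ i, x i ≠ 0 := fun i => h (.inl i) (by simp [arrangementEquations])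
    have hx : (fun i => exp (log (x i))) = x := funext fun i => exp_log (h0 i)
    refine ⟨fun i => log (x i), fun i j hij k hk hk' e => ?_, hx⟩
    refine h (.inr (i, j, k)) (inr_mem_arrangementEquations.2 ⟨hij, hk, hk'⟩) ?_
    rw [← hx]
    exact (hz (fun i => log (x i)) i j k).2 e
  · rintro ⟨z, hsep, rfl⟩ (i | ⟨i, j, k⟩) hc
    · exact exp_ne_zero
    · obtain ⟨hij, hk, hk'⟩ := inr_mem_arrangementEquations.1 hc
      exact fun e => hsep i j hij k hk hk' ((hz z i j k).1 e)

theorem natCast_ne_add_iff {m N u v : ℕ} (hu : u < N) (hv : v < N) :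
    (∀ k : ℤ, -(m : ℤ) ≤ k → k ≤ m → (u : ZMod N) ≠ k + (v : ZMod N)) ↔
      (u + m < v ∨ v + m < u) ∧ u + m < v + N ∧ v + m < u + N := by
  have hcast : ∀ k : ℤ, (u : ZMod N) = k + (v : ZMod N) ↔ (N : ℤ) ∣ u - (k + v) := fun k => by
    rw [← ZMod.intCast_zmod_eq_zero_iff_dvd, ← sub_eq_zero]
    push_cast
    rfl
  constructor
  · intro h
    have h0 := h (u - v)
    have h1 := h (u - v - N)
    have h2 := h (u - v + N)
    rw [Ne, hcast] at h0 h1 h2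
    have d0 : (N : ℤ) ∣ u - (u - v + v) := ⟨0, by ring⟩
    have d1 : (N : ℤ) ∣ u - (u - v - N + v) := ⟨1, by ring⟩
    have d2 : (N : ℤ) ∣ u - (u - v + N + v) := ⟨-1, by ring⟩
    simp only [d0, d1, d2, not_true, imp_false] at h0 h1 h2
    omega
  · intro h k hk hk' e
    rw [hcast] at e
    have := Int.eq_zero_of_abs_lt_dvd e (by rw [abs_lt]; omega)
    omega

theorem isCircularlySeparated_cons_iff {m N p : ℕ} (s : ZMod N) (y : Fin p → ℕ)
    (hN : 2 * m + 1 < N) (hy : ∀ i, y i + m + 1 < N) :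
    IsCircularlySeparated m (Fin.cons s fun i => s + ((y i + m + 1 : ℕ) : ZMod N) :
      Fin (p + 1) → ZMod N) ↔ IsSeparated m (N - 1 - 2 * m) y := by
  have h0 : ∀ i, (∀ k : ℤ, -(m : ℤ) ≤ k → k ≤ m →
      s ≠ k + (s + ((y i + m + 1 : ℕ) : ZMod N))) ↔ y i < N - 1 - 2 * m := fun i => by
    have := natCast_ne_add_iff (m := m) (u := 0) (v := y i + m + 1) (by omega) (hy i)
    refine Iff.trans ?_ (this.trans ⟨fun h => by omega, fun h => by omega⟩)
    refine forall_congr' fun k => forall_congr' fun _ => forall_congr' fun _ => not_congr ?_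
    rw [Nat.cast_zero, add_left_comm, eq_comm, add_eq_left, eq_comm]
  have h1 : (∀ i, y i < N - 1 - 2 * m) → ∀ i j, (∀ k : ℤ, -(m : ℤ) ≤ k → k ≤ m →
      s + ((y i + m + 1 : ℕ) : ZMod N) ≠ k + (s + ((y j + m + 1 : ℕ) : ZMod N))) ↔
      y i + m < y j ∨ y j + m < y i := fun hlt i j => by
    have := natCast_ne_add_iff (m := m) (hy i) (hy j)
    have hi := hlt i
    have hj := hlt j
    refine Iff.trans ?_ (this.trans ⟨fun h => by omega, fun h => by omega⟩)
    refine forall_congr' fun k => forall_congr' fun _ => forall_congr' fun _ => not_congr ?_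
    rw [add_left_comm, add_right_inj]
  constructor
  · intro h
    have hlt : ∀ i, y i < N - 1 - 2 * m := fun i => (h0 i).1 (h 0 i.succ (Fin.succ_pos i))
    have hs : ∀ i j, i < j → y i + m < y j ∨ y j + m < y i := fun i j hij =>
      (h1 hlt i j).1 (h i.succ j.succ (Fin.succ_lt_succ_iff.2 hij))
    exact ⟨hlt, fun i j hij => (lt_or_gt_of_ne hij).elim (hs i j) fun h => (hs j i h).symm⟩
  · rintro ⟨hlt, hs⟩
    refine Fin.cases (Fin.cases ?_ fun j _ => ?_) fun i => Fin.cases ?_ fun j hij => ?_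
    · simp
    · exact (h0 j).2 (hlt j)
    · simp
    · exact (h1 hlt i j).2 (hs i j (Fin.succ_lt_succ_iff.1 hij).ne)

theorem card_isCircularlySeparated {m N p : ℕ} (hN : 2 * m + 1 < N) :
    Nat.card {z : Fin (p + 1) → ZMod N // IsCircularlySeparated m z} =
      N * (N - 1 - m - m * p).descFactorial p := by
  have : NeZero N := ⟨by omega⟩
  rw [show N - 1 - m - m * p = N - 1 - 2 * m + m - m * p by omega, ← card_separated,
    ← Nat.card_eq_finsetCard]
  have hprod : N * Nat.card (separated m (N - 1 - 2 * m) p) =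
      Nat.card (ZMod N × separated m (N - 1 - 2 * m) p) := by rw [Nat.card_prod, Nat.card_zmod]
  rw [hprod]
  have hy : ∀ y : separated m (N - 1 - 2 * m) p, ∀ i, y.1 i + m + 1 < N := fun y i => by
    have := (mem_separated.1 y.2).1 i; omega
  refine (Nat.card_congr (Equiv.ofBijective (fun q => ⟨Fin.cons q.1 fun i =>
    q.1 + ((q.2.1 i + m + 1 : ℕ) : ZMod N),
    (isCircularlySeparated_cons_iff q.1 q.2.1 hN (hy q.2)).2 (mem_separated.1 q.2.2)⟩)
    ⟨?_, ?_⟩)).symm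
  · rintro ⟨s, y⟩ ⟨s', y'⟩ h
    obtain ⟨rfl, h⟩ := Fin.cons_inj (α := fun _ => ZMod N).1 (congrArg Subtype.val h)
    refine Prod.ext rfl (Subtype.ext (funext fun i => ?_))
    have e := add_left_cancel (congrFun h i)
    have e := congrArg ZMod.val e
    rw [ZMod.val_natCast_of_lt (hy y i), ZMod.val_natCast_of_lt (hy y' i)] at e
    simpa using e
  · rintro ⟨z, hz⟩
    have hval : ∀ i : Fin p, m + 1 ≤ (z i.succ - z 0).val := fun i => by
      by_contra hlt
      refine hz 0 i.succ (Fin.succ_pos i) (-((z i.succ - z 0).val : ℤ)) (by omega) (by omega) ?_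
      push_cast
      rw [ZMod.natCast_zmod_val]
      ring
    have hcast : ∀ i : Fin p,
        z 0 + ((((z i.succ - z 0).val - m - 1) + m + 1 : ℕ) : ZMod N) = z i.succ := fun i => by
      have := hval i
      rw [show (z i.succ - z 0).val - m - 1 + m + 1 = (z i.succ - z 0).val by omega,
        ZMod.natCast_zmod_val]
      ring
    have hz' : (Fin.cons (z 0) fun i : Fin p =>
        z 0 + ((((z i.succ - z 0).val - m - 1) + m + 1 : ℕ) : ZMod N)) = z := by
      refine funext (Fin.cases rfl fun i => ?_)
      simpa using hcast i
    refine ⟨⟨z 0, ⟨fun i => (z i.succ - z 0).val - m - 1, mem_separated.2 ?_⟩⟩, Subtype.ext hz'⟩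
    rw [← isCircularlySeparated_cons_iff (z 0) _ hN, hz']
    · exact hz
    · intro i
      have := hval i
      have := ZMod.val_lt (z i.succ - z 0)
      omega

/-- The characteristic polynomial splits into linear factors with explicit roots. -/
theorem charPoly_expCatalan (p m : ℕ) {a : ℝ} (ha : 1 < a) :
    (expCatalan (p + 1) m a).charPoly =
      (X - 1) * ∏ i ∈ Finset.range p, (X - 1 - C ((m * (p + 1) + i + 1 : ℕ) : ℤ)) := by
  obtain ⟨N₀, hN₀⟩ := Filter.eventually_atTop.1 (eventually_eval_charPoly (p + 1) m ha)
  refine eq_of_infinite_eval_eq _ _ (Set.Infinite.mono ?_ (Set.infinite_range_of_injective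
    (f := fun r : ℕ => ((N₀ + 2 * m + 2 + m * (p + 1) + p + r : ℕ) : ℤ) + 1)
    fun r s h => by simpa using h))
  rintro _ ⟨r, rfl⟩
  beta_reduce
  set N := N₀ + 2 * m + 2 + m * (p + 1) + p + r with hN
  have : NeZero N := ⟨by omega⟩
  have hcount : Nat.card {x : Fin (p + 1) → WithZero (Multiplicative (ZMod N)) //
      ∀ c ∈ arrangementEquations (p + 1) m, ¬ c.Holds (WithZero.exp (1 : ZMod N)) x} =
      Nat.card {z : Fin (p + 1) → ZMod N // IsCircularlySeparated m z} := by
    symm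
    refine Nat.card_congr (Equiv.ofBijective (fun z => ⟨fun i => WithZero.exp (z.1 i),
      (forall_not_holds_exp_iff _).2 ⟨z.1, z.2, rfl⟩⟩) ⟨fun z z' h => ?_, fun x => ?_⟩)
    · exact Subtype.ext (funext fun i =>
        WithZero.exp_injective (congrFun (congrArg Subtype.val h) i))
    · obtain ⟨z, hz, e⟩ := (forall_not_holds_exp_iff _).1 x.2
      exact ⟨⟨z, hz⟩, Subtype.ext e⟩
  rw [Set.mem_ofPred_eq, hN₀ N (by omega), hcount, card_isCircularlySeparated (by omega)]
  simp only [eval_mul, eval_sub, eval_X, eval_one, eval_C, eval_prod]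
  rw [Nat.descFactorial_eq_prod_range]
  push_cast
  rw [add_sub_cancel_right]
  congr 1
  refine Finset.prod_congr rfl fun i hi => ?_
  have hi := Finset.mem_range.1 hi
  rw [show N - 1 - m - m * p - i = N - (m * (p + 1) + i + 1) by rw [mul_add]; omega,
    Nat.cast_sub (by omega)]
  push_cast
  ring

/-! ### The factorial Raney polynomials -/

/-- The value at `t` of `t * ∏_{0 < i < n} (t + m * n + i)` (and `1` for `n = 0`), which is `n!`
times the coefficient of `x ^ n` in the `t`-th power of the generating function of the Fuss–Catalan
numbers. -/
def raney (m : ℕ) : ℕ → ℤ → ℤ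
  | 0, _ => 1
  | n + 1, t => t * ∏ i ∈ Finset.range n, (t + m * (n + 1) + i + 1)

theorem raney_zero (m : ℕ) (t : ℤ) : raney m 0 t = 1 := rfl

theorem raney_apply_zero (m n : ℕ) : raney m n 0 = if n = 0 then 1 else 0 := by
  cases n <;> simp [raney]

theorem raney_succ_add_one (m n : ℕ) (t : ℤ) :
    raney m (n + 1) (t + 1) = raney m (n + 1) t + (n + 1) * raney m n (t + 1 + m) := by
  rcases n with _ | n
  · simp [raney]
  · have e1 : ∏ i ∈ Finset.range n, (t + m * ((n + 1 : ℕ) + 1) + (i + 1 : ℕ) + 1) =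
        ∏ i ∈ Finset.range n, (t + 1 + m * ((n + 1 : ℕ) + 1) + i + 1) :=
      Finset.prod_congr rfl fun i _ => by push_cast; ring
    have e2 : ∏ i ∈ Finset.range n, (t + 1 + m + m * (n + 1) + i + 1) =
        ∏ i ∈ Finset.range n, (t + 1 + m * ((n + 1 : ℕ) + 1) + i + 1) :=
      Finset.prod_congr rfl fun i _ => by push_cast; ring
    rw [raney, raney, raney, Finset.prod_range_succ, Finset.prod_range_succ', e1, e2]
    push_cast
    ring

theorem raney_card_add_one {α : Type*} [DecidableEq α] (m : ℕ) (S : Finset α) (t : ℤ) :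
    raney m S.card (t + 1) =
      raney m S.card t + ∑ l ∈ S, raney m (S.erase l).card (t + 1 + m) := by
  rcases hn : S.card with _ | n
  · rw [Finset.card_eq_zero.1 hn]
    simp [raney]
  · rw [Finset.sum_congr rfl fun l hl => by
        rw [Finset.card_erase_of_mem hl, hn, Nat.add_sub_cancel],
      Finset.sum_const, hn, raney_succ_add_one]
    simp

/-- The sequence `raney m` is of binomial type. -/
theorem sum_powerset_raney_mul_raney {α : Type*} [DecidableEq α] (m : ℕ) (S : Finset α) (s : ℤ)
    (t : ℕ) :
    ∑ U ∈ S.powerset, raney m U.card s * raney m (S \ U).card t = raney m S.card (s + t) := by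
  induction hn : S.card using Nat.strong_induction_on generalizing S t with
  | _ n ih =>
    induction t with
    | zero =>
      rw [Finset.sum_eq_single_of_mem S (Finset.mem_powerset_self S)]
      · simp [raney_zero, hn]
      · intro U hU hne
        have : S \ U ≠ ∅ := fun h =>
          hne ((Finset.mem_powerset.1 hU).antisymm (Finset.sdiff_eq_empty_iff_subset.1 h))
        simp [raney_apply_zero, this]
    | succ t iht =>
      have step : ∀ U, raney m U.card s * raney m (S \ U).card ((t + 1 : ℕ) : ℤ) =
          raney m U.card s * raney m (S \ U).card t +
            ∑ l ∈ S \ U, raney m U.card s *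
              raney m ((S.erase l) \ U).card ((t + 1 + m : ℕ) : ℤ) := fun U => by
        rw [Nat.cast_succ, raney_card_add_one, mul_add, Finset.mul_sum]
        simp only [Finset.erase_sdiff_comm]
        push_cast
        rfl
      rw [Finset.sum_congr rfl fun U _ => step U, Finset.sum_add_distrib, iht,
        Finset.sum_comm' (t' := S) (s' := fun l => (S.erase l).powerset)]
      · rw [Finset.sum_congr rfl fun l hl => ih _ (by
          rw [← hn]; exact Finset.card_erase_lt_of_mem hl) (S.erase l) (t + 1 + m) rfl, ← hn,
          Nat.cast_succ, ← add_assoc, raney_card_add_one]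
        push_cast
        simp only [add_assoc]
      · intro U l
        simp only [Finset.mem_powerset, Finset.mem_sdiff, Finset.subset_erase]
        tauto

/-! ### Enumerating labeled paths -/

@[simp] theorem stepLabels_nil : stepLabels [] = [] := rfl

@[simp] theorem stepLabels_up (l : ℕ) (w : List LStep) :
    stepLabels (.up l :: w) = l :: stepLabels w := rfl

@[simp] theorem stepLabels_down (w : List LStep) : stepLabels (.down :: w) = stepLabels w := rfl

@[simp] theorem stepLabels_append (u v : List LStep) :
    stepLabels (u ++ v) = stepLabels u ++ stepLabels v := List.filterMap_append

@[simp] theorem endHeight_nil (m : ℕ) : endHeight m [] = 0 := rfl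

@[simp] theorem endHeight_cons (m : ℕ) (s : LStep) (w : List LStep) :
    endHeight m (s :: w) = s.rise m + endHeight m w := by simp [endHeight]

@[simp] theorem endHeight_append (m : ℕ) (u v : List LStep) :
    endHeight m (u ++ v) = endHeight m u + endHeight m v := by simp [endHeight]

theorem endHeight_eq (m : ℕ) (w : List LStep) :
    endHeight m w = m * (stepLabels w).length - w.count .down := by
  induction w with
  | nil => simp
  | cons s w ih =>
    rcases s with l | _
    · simp [LStep.rise, ih]; ring
    · simp [LStep.rise, ih]; ring

/-- A labeled path with label set `S` that starts at height `h`, ends at height `0` and never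
goes below height `0`. -/
structure IsPathFrom (m h : ℕ) (S : Finset ℕ) (w : List LStep) : Prop where
  nodup : (stepLabels w).Nodup
  labels : (stepLabels w).toFinset = S
  ends : h + endHeight m w = 0
  nonneg : ∀ u, u <+: w → 0 ≤ h + endHeight m u

theorem isLabeledDyckPath_iff {m : ℕ} {S : Finset ℕ} {w : List LStep} :
    IsLabeledDyckPath m S w ↔ IsPathFrom m 0 S w := by
  constructor
  · rintro ⟨h1, h2, h3, h4⟩
    refine ⟨h1, h2, ?_, by simpa using h4⟩
    rw [endHeight_eq, h3, ← h2, List.toFinset_card_of_nodup h1]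
    simp
  · rintro ⟨h1, h2, h3, h4⟩
    refine ⟨h1, h2, ?_, by simpa using h4⟩
    rw [endHeight_eq] at h3
    rw [← h2, List.toFinset_card_of_nodup h1]
    zify
    push_cast at h3
    linarith

theorem isPathFrom_nil {m h : ℕ} {S : Finset ℕ} : IsPathFrom m h S [] ↔ h = 0 ∧ S = ∅ := by
  constructor
  · rintro ⟨-, h2, h3, -⟩
    exact ⟨by simpa using h3, by simpa using h2.symm⟩
  · rintro ⟨rfl, rfl⟩
    exact ⟨by simp, by simp, by simp, by simp⟩

theorem isPathFrom_up {m h l : ℕ} {S : Finset ℕ} {w : List LStep} :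
    IsPathFrom m h S (.up l :: w) ↔ l ∈ S ∧ IsPathFrom m (h + m) (S.erase l) w := by
  constructor
  · rintro ⟨h1, h2, h3, h4⟩
    rw [stepLabels_up, List.nodup_cons] at h1
    rw [stepLabels_up, List.toFinset_cons] at h2
    refine ⟨h2 ▸ Finset.mem_insert_self _ _, h1.2, ?_, ?_, fun u hu => ?_⟩
    · rw [← h2, Finset.erase_insert (by simpa using h1.1)]
    · simpa [LStep.rise, add_assoc] using h3
    · simpa [LStep.rise, add_assoc] using h4 (.up l :: u) (by simpa using hu)
  · rintro ⟨hl, h1, h2, h3, h4⟩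
    refine ⟨?_, ?_, ?_, fun u hu => ?_⟩
    · rw [stepLabels_up, List.nodup_cons]
      refine ⟨fun h => ?_, h1⟩
      rw [← List.mem_toFinset, h2] at h
      simp at h
    · rw [stepLabels_up, List.toFinset_cons, h2, Finset.insert_erase hl]
    · simpa [LStep.rise, add_assoc] using h3
    · rcases List.prefix_cons_iff.1 hu with rfl | ⟨u', rfl, hu'⟩
      · simp
      · simpa [LStep.rise, add_assoc] using h4 u' hu'

theorem isPathFrom_down {m h : ℕ} {S : Finset ℕ} {w : List LStep} :
    IsPathFrom m h S (.down :: w) ↔ ∃ h', h = h' + 1 ∧ IsPathFrom m h' S w := by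
  constructor
  · rintro ⟨h1, h2, h3, h4⟩
    have hh : 0 ≤ (h : ℤ) - 1 := by
      simpa [LStep.rise, sub_eq_add_neg] using h4 [.down] (by simp)
    refine ⟨h - 1, by omega, h1, h2, ?_, fun u hu => ?_⟩
    · rw [endHeight_cons, LStep.rise] at h3
      omega
    · have := h4 (.down :: u) (by simpa using hu)
      rw [endHeight_cons, LStep.rise] at this
      omega
  · rintro ⟨h', rfl, h1, h2, h3, h4⟩
    refine ⟨h1, h2, ?_, fun u hu => ?_⟩
    · rw [endHeight_cons, LStep.rise]
      push_cast
      linarith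
    · rcases List.prefix_cons_iff.1 hu with rfl | ⟨u', rfl, hu'⟩
      · rw [endHeight_nil]; positivity
      · have := h4 u' hu'
        rw [endHeight_cons, LStep.rise]
        push_cast
        linarith

/-- The paths from height `h` obey the recurrence of `raney`: the first step is a down-step, or an
up-step with some label. -/
theorem exists_finset_isPathFrom (m h : ℕ) (S : Finset ℕ) :
    ∃ F : Finset (List LStep), (∀ w, w ∈ F ↔ IsPathFrom m h S w) ∧
      (F.card : ℤ) = raney m S.card (h + 1) := by
  induction hk : (m + 1) * S.card + h using Nat.strong_induction_on generalizing h S with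
  | _ k ih =>
    have hup : ∀ l, ∃ F : Finset (List LStep), l ∈ S →
        (∀ w, w ∈ F ↔ IsPathFrom m (h + m) (S.erase l) w) ∧
          (F.card : ℤ) = raney m (S.erase l).card (h + 1 + m) := by
      intro l
      by_cases hl : l ∈ S
      · obtain ⟨c, hc⟩ : ∃ c, S.card = c + 1 :=
          Nat.exists_eq_add_one_of_ne_zero (Finset.card_ne_zero_of_mem hl)
        obtain ⟨F, hF, hcard⟩ := ih _ (by
          rw [← hk, Finset.card_erase_of_mem hl, hc, Nat.add_sub_cancel]
          linarith) (h + m) (S.erase l) rfl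
        refine ⟨F, fun _ => ⟨hF, ?_⟩⟩
        rw [hcard]
        congr 1
        push_cast
        ring
      · exact ⟨∅, fun h => absurd h hl⟩
    choose F hF using hup
    have hdown : ∃ F₀ : Finset (List LStep), (F₀.card : ℤ) = raney m S.card h ∧
        ∀ w, w ∈ F₀ ↔ IsPathFrom m h S w ∧ ∀ l v, w ≠ .up l :: v := by
      rcases h with _ | h
      · refine ⟨if S = ∅ then {[]} else ∅, ?_, fun w => ?_⟩
        · rw [Nat.cast_zero, raney_apply_zero]
          by_cases hS : S = ∅ <;> simp [hS]
        · rcases w with _ | ⟨l | _, w⟩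
          · rw [isPathFrom_nil]; split_ifs with h <;> simp [h]
          · split_ifs <;> simp
          · rw [isPathFrom_down]; split_ifs <;> simp
      · obtain ⟨F₀, hF₀, hcard⟩ := ih _ (by omega) h S rfl
        refine ⟨F₀.image (List.cons .down), ?_, fun w => ?_⟩
        · rw [Finset.card_image_of_injective _ List.cons_injective, hcard]
          push_cast
          rfl
        · rcases w with _ | ⟨l | _, w⟩
          · simp [isPathFrom_nil]
          · simp
          · simp [isPathFrom_down, hF₀]
    obtain ⟨F₀, hcard, hF₀⟩ := hdown
    refine ⟨F₀ ∪ S.biUnion fun l => (F l).image (List.cons (.up l)), fun w => ?_, ?_⟩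
    · simp only [Finset.mem_union, Finset.mem_biUnion, Finset.mem_image, hF₀]
      constructor
      · rintro (h | ⟨l, hl, v, hv, rfl⟩)
        · exact h.1
        · exact isPathFrom_up.2 ⟨hl, ((hF l hl).1 v).1 hv⟩
      · intro hw
        by_cases h : ∃ l v, w = .up l :: v
        · obtain ⟨l, v, rfl⟩ := h
          obtain ⟨hl, hv⟩ := isPathFrom_up.1 hw
          exact Or.inr ⟨l, hl, v, ((hF l hl).1 v).2 hv, rfl⟩
        · exact Or.inl ⟨hw, fun l v e => h ⟨l, v, e⟩⟩
    · rw [Finset.card_union_of_disjoint, Finset.card_biUnion, raney_card_add_one]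
      · push_cast
        rw [hcard]
        congr 1
        refine Finset.sum_congr rfl fun l hl => ?_
        rw [Finset.card_image_of_injective _ List.cons_injective, (hF l hl).2]
      · intro l _ l' _ hne
        refine Finset.disjoint_left.2 fun w hw hw' => hne ?_
        obtain ⟨v, -, rfl⟩ := Finset.mem_image.1 hw
        obtain ⟨v', -, e⟩ := Finset.mem_image.1 hw'
        simpa using (List.cons.inj e).1.symm
      · refine Finset.disjoint_left.2 fun w hw hw' => ?_
        obtain ⟨l, -, hl⟩ := Finset.mem_biUnion.1 hw'
        obtain ⟨v, -, rfl⟩ := Finset.mem_image.1 hl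
        exact ((hF₀ _).1 hw).2 l v rfl

/-- The labeled `m`-Dyck paths with label set `S`. -/
noncomputable def dyckPaths (m : ℕ) (S : Finset ℕ) : Finset (List LStep) :=
  (exists_finset_isPathFrom m 0 S).choose

theorem mem_dyckPaths {m : ℕ} {S : Finset ℕ} {w : List LStep} :
    w ∈ dyckPaths m S ↔ IsPathFrom m 0 S w :=
  (exists_finset_isPathFrom m 0 S).choose_spec.1 w

theorem card_dyckPaths (m : ℕ) (S : Finset ℕ) : ((dyckPaths m S).card : ℤ) = raney m S.card 1 :=
  (exists_finset_isPathFrom m 0 S).choose_spec.2.trans (by simp)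

theorem IsPathFrom.append {m : ℕ} {S T : Finset ℕ} {u v : List LStep} (hu : IsPathFrom m 0 S u)
    (hv : IsPathFrom m 0 T v) (hST : Disjoint S T) : IsPathFrom m 0 (S ∪ T) (u ++ v) := by
  have eu : endHeight m u = 0 := by simpa using hu.ends
  have ev : endHeight m v = 0 := by simpa using hv.ends
  refine ⟨?_, ?_, ?_, fun x hx => ?_⟩
  · rw [stepLabels_append, List.nodup_append']
    refine ⟨hu.nodup, hv.nodup, ?_⟩
    rw [← List.disjoint_toFinset_iff_disjoint, hu.labels, hv.labels]
    exact hST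
  · rw [stepLabels_append, List.toFinset_append, hu.labels, hv.labels]
  · simp [eu, ev]
  · rcases List.prefix_or_prefix_of_prefix hx (List.prefix_append u v) with hx | ⟨y, rfl⟩
    · exact hu.nonneg x hx
    · simpa [eu] using hv.nonneg y ((List.prefix_append_right_inj u).1 hx)

theorem IsPathFrom.of_append {m : ℕ} {S : Finset ℕ} {u v : List LStep}
    (h : IsPathFrom m 0 S (u ++ v)) (hu : endHeight m u = 0) :
    (stepLabels u).toFinset ⊆ S ∧ IsPathFrom m 0 (stepLabels u).toFinset u ∧
      IsPathFrom m 0 (S \ (stepLabels u).toFinset) v := by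
  have hn := h.nodup
  rw [stepLabels_append, List.nodup_append'] at hn
  have hl := h.labels
  rw [stepLabels_append, List.toFinset_append] at hl
  refine ⟨hl ▸ Finset.subset_union_left, ⟨hn.1, rfl, by simp [hu], fun x hx => ?_⟩,
    ⟨hn.2.1, ?_, ?_, fun x hx => ?_⟩⟩
  · exact h.nonneg x (hx.trans (List.prefix_append u v))
  · rw [← hl, Finset.union_sdiff_cancel_left]
    exact List.disjoint_toFinset_iff_disjoint.2 hn.2.2
  · simpa [hu] using h.ends
  · simpa [hu] using h.nonneg (u ++ x) ((List.prefix_append_right_inj u).2 hx)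

/-! ### Splitting off the first compartment -/

theorem flatten_cutAtReturns (m : ℕ) (h : ℤ) (acc w : List LStep) :
    (cutAtReturns m h acc w).flatten = acc ++ w := by
  induction w generalizing h acc with
  | nil => rw [cutAtReturns]; split_ifs with h <;> simp [h]
  | cons s w ih => rw [cutAtReturns]; split_ifs <;> simp [ih]

theorem cutAtReturns_append {m : ℕ} {h : ℤ} {acc u : List LStep} (v : List LStep)
    (hacc : h = 0 → acc = []) (hu : h + endHeight m u = 0) :
    cutAtReturns m h acc (u ++ v) = cutAtReturns m h acc u ++ cutAtReturns m 0 [] v := by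
  induction u generalizing h acc with
  | nil =>
    obtain rfl : h = 0 := by simpa using hu
    simp [hacc rfl, cutAtReturns]
  | cons s u ih =>
    rw [endHeight_cons, ← add_assoc] at hu
    rw [List.cons_append, cutAtReturns, cutAtReturns]
    split_ifs with h0
    · rw [List.cons_append, ih (fun _ => rfl) (by rwa [h0] at hu)]
    · exact ih (fun h => absurd h h0) hu

theorem ne_nil_and_endHeight_of_mem_cutAtReturns {m : ℕ} {h : ℤ} {acc w Q : List LStep}
    (hacc : endHeight m acc = h) (h0 : h = 0 → acc = []) (hw : h + endHeight m w = 0)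
    (hQ : Q ∈ cutAtReturns m h acc w) : Q ≠ [] ∧ endHeight m Q = 0 := by
  induction w generalizing h acc with
  | nil =>
    obtain rfl : h = 0 := by simpa using hw
    simp [h0 rfl, cutAtReturns] at hQ
  | cons s w ih =>
    rw [endHeight_cons, ← add_assoc] at hw
    rw [cutAtReturns] at hQ
    split_ifs at hQ with h1
    · rcases List.mem_cons.1 hQ with rfl | hQ
      · simpa [hacc] using h1
      · exact ih rfl (fun _ => rfl) (by rwa [h1] at hw) hQ
    · exact ih (by simp [hacc]) (fun h => absurd h h1) hw hQ

theorem primitiveParts_append {m : ℕ} {u : List LStep} (v : List LStep) (hu : endHeight m u = 0) :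
    primitiveParts m (u ++ v) = primitiveParts m u ++ primitiveParts m v :=
  cutAtReturns_append v (fun _ => rfl) (by simpa using hu)

theorem flatten_primitiveParts (m : ℕ) (w : List LStep) : (primitiveParts m w).flatten = w :=
  flatten_cutAtReturns m 0 [] w

theorem ne_nil_and_endHeight_of_mem_primitiveParts {m : ℕ} {w Q : List LStep}
    (hw : endHeight m w = 0) (hQ : Q ∈ primitiveParts m w) : Q ≠ [] ∧ endHeight m Q = 0 :=
  ne_nil_and_endHeight_of_mem_cutAtReturns rfl (fun _ => rfl) (by simpa using hw) hQ

theorem endHeight_flatten {m : ℕ} {L : List (List LStep)} (h : ∀ Q ∈ L, endHeight m Q = 0) :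
    endHeight m L.flatten = 0 := by
  induction L with
  | nil => rfl
  | cons Q L ih =>
    rw [List.flatten_cons, endHeight_append, h Q (by simp), ih fun Q hQ => h Q (by simp [hQ])]
    rfl

theorem mem_stepLabels_flatten {M : ℕ} {L : List (List LStep)} :
    M ∈ stepLabels L.flatten ↔ ∃ Q ∈ L, M ∈ stepLabels Q := by
  induction L with
  | nil => simp
  | cons Q L ih => simp [ih]

theorem groupParts_append_cons {Qs Rs : List (List LStep)} {Q : List LStep}
    (hQs : ∀ P ∈ Qs, maxLabel (Qs ++ Q :: Rs).flatten ∉ stepLabels P)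
    (hQ : maxLabel (Qs ++ Q :: Rs).flatten ∈ stepLabels Q) :
    groupParts (Qs ++ Q :: Rs) = (Qs ++ [Q]).flatten :: groupParts Rs := by
  have hidx : (Qs ++ Q :: Rs).findIdx
      (fun P => decide (maxLabel (Qs ++ Q :: Rs).flatten ∈ stepLabels P)) = Qs.length := by
    rw [List.findIdx_append, if_neg (by simpa using hQs), List.findIdx_cons]
    simp only [decide_eq_true hQ, cond_true, zero_add]
  have htake : (Qs ++ Q :: Rs).take (Qs.length + 1) = Qs ++ [Q] := by simp [List.take_append]
  have hdrop : (Qs ++ Q :: Rs).drop (Qs.length + 1) = Rs := by simp [List.drop_append]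
  obtain ⟨P, Ps, hL⟩ : ∃ P Ps, Qs ++ Q :: Rs = P :: Ps :=
    List.exists_cons_of_ne_nil (by simp)
  rw [hL] at hidx htake hdrop ⊢
  rw [groupParts, hidx, htake, hdrop]

theorem maxLabel_eq {w : List LStep} {M : ℕ} (hM : M ∈ stepLabels w)
    (hmax : ∀ x ∈ stepLabels w, x ≤ M) : maxLabel w = M := by
  have hle : ∀ l : List ℕ, (∀ x ∈ l, x ≤ M) → l.foldr max 0 ≤ M := fun l => by
    induction l with
    | nil => simp
    | cons a l ih => simpa using fun h h' => ⟨h, ih h'⟩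
  have hge : ∀ l : List ℕ, M ∈ l → M ≤ l.foldr max 0 := fun l => by
    induction l with
    | nil => simp
    | cons a l ih =>
      rw [List.mem_cons, List.foldr_cons]
      rintro (rfl | h)
      · exact le_max_left _ _
      · exact (ih h).trans (le_max_right _ _)
  exact le_antisymm (hle _ hmax) (hge _ hM)

/-- `u` reaches the label `M` only in its last primitive part: no proper prefix ending on the
axis contains `M`. -/
def IsTightAt (m M : ℕ) (u : List LStep) : Prop :=
  ∀ v, v <+: u → endHeight m v = 0 → M ∈ stepLabels v → v = u

/-- If `M` is the largest label of `u ++ v`, and `u` is the shortest part of the path that ends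
on the axis and contains `M`, then `u` is the first compartment. -/
theorem compartments_append {m M : ℕ} {u v : List LStep} (hu : endHeight m u = 0)
    (hMu : M ∈ stepLabels u) (ht : IsTightAt m M u) (hmax : ∀ x ∈ stepLabels (u ++ v), x ≤ M) :
    compartments m (u ++ v) = u :: compartments m v := by
  have hne : primitiveParts m u ≠ [] := fun h => by
    have := flatten_primitiveParts m u
    rw [h] at this
    simp [← this] at hMu
  obtain ⟨Qs, Q, hparts⟩ := List.eq_nil_or_concat (primitiveParts m u) |>.resolve_left hne
  rw [List.concat_eq_append] at hparts
  have hflat : Qs.flatten ++ Q = u := by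
    rw [← flatten_primitiveParts m u, hparts]; simp
  have hQ : Q ≠ [] :=
    (ne_nil_and_endHeight_of_mem_primitiveParts hu (Q := Q) (by simp [hparts])).1
  have hQs : M ∉ stepLabels Qs.flatten := fun h => by
    refine hQ ?_
    have := ht Qs.flatten ⟨Q, hflat⟩ (endHeight_flatten fun P hP =>
      (ne_nil_and_endHeight_of_mem_primitiveParts hu (Q := P) (by simp [hparts, hP])).2) h
    rw [← hflat] at this
    simpa using this
  have hMQ : M ∈ stepLabels Q := by
    rw [← hflat, stepLabels_append, List.mem_append] at hMu
    exact hMu.resolve_left hQs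
  have hw : (Qs ++ Q :: primitiveParts m v).flatten = u ++ v := by
    rw [List.flatten_append, List.flatten_cons, flatten_primitiveParts, ← List.append_assoc, hflat]
  have hM : maxLabel (u ++ v) = M := maxLabel_eq (by simp [hMu]) hmax
  rw [compartments, primitiveParts_append v hu, hparts, List.append_assoc, List.singleton_append,
    groupParts_append_cons, compartments]
  · simp [hflat]
  · rw [hw, hM]
    exact fun P hP h => hQs (mem_stepLabels_flatten.2 ⟨P, hP, h⟩)
  · rwa [hw, hM]

theorem exists_isTightAt_append {m M : ℕ} {w : List LStep} (hw : endHeight m w = 0)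
    (hM : M ∈ stepLabels w) :
    ∃ u v, w = u ++ v ∧ endHeight m u = 0 ∧ M ∈ stepLabels u ∧ IsTightAt m M u := by
  classical
  have hex : ∃ k, endHeight m (w.take k) = 0 ∧ M ∈ stepLabels (w.take k) :=
    ⟨w.length, by simpa using ⟨hw, hM⟩⟩
  refine ⟨w.take (Nat.find hex), w.drop (Nat.find hex), (List.take_append_drop _ _).symm,
    (Nat.find_spec hex).1, (Nat.find_spec hex).2, fun v hv hv0 hvM => ?_⟩
  have hvw : v = w.take v.length := List.prefix_iff_eq_take.1 (hv.trans (List.take_prefix _ _))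
  have hle : Nat.find hex ≤ v.length := Nat.find_min' hex (by rw [← hvw]; exact ⟨hv0, hvM⟩)
  refine hv.eq_of_length_le ?_
  rw [List.length_take]
  omega

/-! ### The compartment enumerator -/

/-- The compartment enumerator `∑ t ^ (number of compartments)` of the labeled Dyck paths. -/
noncomputable def compartmentSum (m : ℕ) (S : Finset ℕ) (t : ℤ) : ℤ :=
  ∑ w ∈ dyckPaths m S, t ^ (compartments m w).length

open Classical in
/-- The paths with label set `T` that can be a compartment with largest label `M`. -/
noncomputable def tightPaths (m M : ℕ) (T : Finset ℕ) : Finset (List LStep) :=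
  (dyckPaths m T).filter (IsTightAt m M)

/-- A path is uniquely its first compartment followed by another path. -/
theorem compartmentSum_eq {m M : ℕ} {S : Finset ℕ} (hM : M ∈ S) (hmax : ∀ x ∈ S, x ≤ M) (t : ℤ) :
    compartmentSum m S t = t * ∑ T ∈ S.powerset with M ∈ T,
      ((tightPaths m M T).card : ℤ) * compartmentSum m (S \ T) t := by
  have hR : t * ∑ T ∈ S.powerset with M ∈ T,
      ((tightPaths m M T).card : ℤ) * compartmentSum m (S \ T) t =
      ∑ q ∈ (S.powerset.filter (M ∈ ·)).sigma fun T => tightPaths m M T ×ˢ dyckPaths m (S \ T),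
        t ^ ((compartments m q.2.2).length + 1) := by
    rw [Finset.sum_sigma, Finset.mul_sum]
    refine Finset.sum_congr rfl fun T _ => ?_
    rw [Finset.sum_product]
    dsimp only
    rw [Finset.sum_const, compartmentSum, nsmul_eq_mul, mul_left_comm,
      Finset.mul_sum]
    simp only [pow_succ']
  have hmem : ∀ q : (_ : Finset ℕ) × (List LStep × List LStep),
      q ∈ (S.powerset.filter (M ∈ ·)).sigma (fun T => tightPaths m M T ×ˢ dyckPaths m (S \ T)) ↔
      (q.1 ⊆ S ∧ M ∈ q.1) ∧ (IsPathFrom m 0 q.1 q.2.1 ∧ IsTightAt m M q.2.1) ∧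
        IsPathFrom m 0 (S \ q.1) q.2.2 := fun q => by
    simp only [Finset.mem_sigma, Finset.mem_filter, Finset.mem_powerset, Finset.mem_product,
      tightPaths, mem_dyckPaths]
  rw [hR, compartmentSum]
  symm
  refine Finset.sum_bij (fun q _ => q.2.1 ++ q.2.2) ?_ ?_ ?_ ?_
  · intro q hq
    obtain ⟨⟨hT, -⟩, ⟨hu, -⟩, hv⟩ := (hmem q).1 hq
    rw [mem_dyckPaths]
    simpa [Finset.union_sdiff_of_subset hT] using hu.append hv Finset.disjoint_sdiff
  · rintro ⟨T, u, v⟩ hq ⟨T', u', v'⟩ hq' he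
    obtain ⟨⟨-, hMT⟩, ⟨hu, ht⟩, -⟩ := (hmem _).1 hq
    obtain ⟨⟨-, hMT'⟩, ⟨hu', ht'⟩, -⟩ := (hmem _).1 hq'
    dsimp only at hMT hu ht hMT' hu' ht' he
    have huu : u = u' := by
      rcases List.prefix_or_prefix_of_prefix (List.prefix_append u v)
        (he ▸ List.prefix_append u' v') with h | h
      · exact ht' u h (by simpa using hu.ends) (by rwa [← List.mem_toFinset, hu.labels])
      · exact (ht u' h (by simpa using hu'.ends) (by rwa [← List.mem_toFinset, hu'.labels])).symm
    subst huu
    obtain rfl := List.append_cancel_left he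
    obtain rfl : T = T' := hu.labels.symm.trans hu'.labels
    rfl
  · intro w hw
    rw [mem_dyckPaths] at hw
    obtain ⟨u, v, rfl, hu0, hMu, ht⟩ := exists_isTightAt_append (m := m) (M := M) (w := w)
      (by simpa using hw.ends) (by rwa [← List.mem_toFinset, hw.labels])
    obtain ⟨hsub, hu, hv⟩ := hw.of_append hu0
    exact ⟨⟨(stepLabels u).toFinset, u, v⟩,
      (hmem _).2 ⟨⟨hsub, List.mem_toFinset.2 hMu⟩, ⟨hu, ht⟩, hv⟩, rfl⟩
  · rintro ⟨T, u, v⟩ hq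
    obtain ⟨⟨hT, hMT⟩, ⟨hu, ht⟩, hv⟩ := (hmem _).1 hq
    dsimp only at hT hMT hu ht hv ⊢
    rw [compartments_append (by simpa using hu.ends) (by rwa [← List.mem_toFinset, hu.labels]) ht,
      List.length_cons]
    intro x hx
    refine hmax x ?_
    rw [stepLabels_append, List.mem_append, ← List.mem_toFinset, ← List.mem_toFinset, hu.labels,
      hv.labels] at hx
    rcases hx with hx | hx
    · exact hT hx
    · exact (Finset.mem_sdiff.1 hx).1

theorem compartmentSum_empty (m : ℕ) (t : ℤ) : compartmentSum m ∅ t = 1 := by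
  have : dyckPaths m ∅ = {[]} := by
    ext w
    rw [mem_dyckPaths, Finset.mem_singleton]
    constructor
    · intro h
      rcases w with _ | ⟨l | _, w⟩
      · rfl
      · simpa using (isPathFrom_up.1 h).1
      · obtain ⟨h', e, -⟩ := isPathFrom_down.1 h
        simp at e
    · rintro rfl
      exact isPathFrom_nil.2 ⟨rfl, rfl⟩
  simp [compartmentSum, this, compartments, primitiveParts, cutAtReturns, groupParts]

theorem compartmentSum_one (m : ℕ) (S : Finset ℕ) :
    compartmentSum m S 1 = raney m S.card 1 := by
  rw [← card_dyckPaths]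
  simp [compartmentSum]

/-- The compartment enumerator is of binomial type: in exponential generating functions, the
compartments of a path form a set of structures. -/
theorem compartmentSum_add (m : ℕ) (S : Finset ℕ) (s t : ℤ) :
    compartmentSum m S (s + t) =
      ∑ U ∈ S.powerset, compartmentSum m U s * compartmentSum m (S \ U) t := by
  induction hn : S.card using Nat.strong_induction_on generalizing S with
  | _ n ih =>
    rcases S.eq_empty_or_nonempty with rfl | hS
    · simp [compartmentSum_empty]
    let M := S.max' hS
    have hM : M ∈ S := S.max'_mem hS
    have hmax : ∀ x ∈ S, x ≤ M := fun x hx => S.le_max' x hx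
    -- The terms with `M ∈ U`: split off the first compartment of the path labeled by `U`.
    have half : ∀ s t : ℤ,
        (∀ T ⊆ S, M ∈ T → compartmentSum m (S \ T) (s + t) =
          ∑ U ∈ (S \ T).powerset, compartmentSum m U s * compartmentSum m ((S \ T) \ U) t) →
        ∑ U ∈ S.powerset with M ∈ U, compartmentSum m U s * compartmentSum m (S \ U) t =
          s * ∑ T ∈ S.powerset with M ∈ T,
            ((tightPaths m M T).card : ℤ) * compartmentSum m (S \ T) (s + t) := by
      intro s t hst
      have e1 : ∀ U ∈ S.powerset.filter (M ∈ ·),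
          compartmentSum m U s * compartmentSum m (S \ U) t =
          ∑ T ∈ U.powerset with M ∈ T, s * (((tightPaths m M T).card : ℤ) *
            (compartmentSum m (U \ T) s * compartmentSum m (S \ U) t)) := fun U hU => by
        obtain ⟨hUS, hMU⟩ := Finset.mem_filter.1 hU
        rw [compartmentSum_eq hMU fun x hx => hmax x (Finset.mem_powerset.1 hUS hx), mul_assoc,
          Finset.sum_mul, Finset.mul_sum]
        exact Finset.sum_congr rfl fun _ _ => by ring
      have e2 : ∀ T ∈ S.powerset.filter (M ∈ ·),
          s * (((tightPaths m M T).card : ℤ) * compartmentSum m (S \ T) (s + t)) =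
          ∑ U ∈ (S \ T).powerset, s * (((tightPaths m M T).card : ℤ) *
            (compartmentSum m U s * compartmentSum m ((S \ T) \ U) t)) := fun T hT => by
        obtain ⟨hTS, hMT⟩ := Finset.mem_filter.1 hT
        rw [hst T (Finset.mem_powerset.1 hTS) hMT, Finset.mul_sum, Finset.mul_sum]
      rw [Finset.mul_sum, Finset.sum_congr rfl e1, Finset.sum_congr rfl e2, Finset.sum_sigma',
        Finset.sum_sigma']
      refine Finset.sum_bij' (fun q _ => ⟨q.2, q.1 \ q.2⟩) (fun q _ => ⟨q.1 ∪ q.2, q.1⟩)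
        ?_ ?_ ?_ ?_ ?_
      · rintro ⟨U, T⟩ h
        simp only [Finset.mem_sigma, Finset.mem_filter, Finset.mem_powerset] at h ⊢
        exact ⟨⟨h.2.1.trans h.1.1, h.2.2⟩, Finset.sdiff_subset_sdiff h.1.1 subset_rfl⟩
      · rintro ⟨T, U⟩ h
        simp only [Finset.mem_sigma, Finset.mem_filter, Finset.mem_powerset] at h ⊢
        exact ⟨⟨Finset.union_subset h.1.1 (h.2.trans Finset.sdiff_subset),
          Finset.mem_union_left _ h.1.2⟩, Finset.subset_union_left, h.1.2⟩
      · rintro ⟨U, T⟩ h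
        simp only [Finset.mem_sigma, Finset.mem_filter, Finset.mem_powerset] at h
        simp only [Finset.union_sdiff_of_subset h.2.1]
      · rintro ⟨T, U⟩ h
        simp only [Finset.mem_sigma, Finset.mem_filter, Finset.mem_powerset] at h
        have : Disjoint T U := (Finset.subset_sdiff.1 h.2).2.symm
        simp only [Finset.union_sdiff_cancel_left this]
      · rintro ⟨U, T⟩ h
        simp only [Finset.mem_sigma, Finset.mem_filter, Finset.mem_powerset] at h
        dsimp only
        rw [sdiff_sdiff_left, Finset.sup_eq_union, Finset.union_sdiff_of_subset h.2.1]
    have ih' : ∀ T ⊆ S, M ∈ T → compartmentSum m (S \ T) (s + t) =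
        ∑ U ∈ (S \ T).powerset, compartmentSum m U s * compartmentSum m ((S \ T) \ U) t :=
      fun T hT hMT => ih _ (by
        rw [← hn]
        exact Finset.card_lt_card (Finset.sdiff_ssubset hT ⟨M, hMT⟩)) (S \ T) rfl
    -- Complementation turns the terms with `M ∉ U` into terms with `M ∈ U`, exchanging `s` and `t`.
    have swap : ∀ (V : Finset ℕ) (P : Finset ℕ → Prop) [DecidablePred P] [DecidablePred
        fun U => P (V \ U)], ∑ U ∈ V.powerset with P (V \ U),
          compartmentSum m U s * compartmentSum m (V \ U) t =
        ∑ U ∈ V.powerset with P U, compartmentSum m U t * compartmentSum m (V \ U) s := by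
      intro V P _ _
      refine Finset.sum_bij' (fun U _ => V \ U) (fun U _ => V \ U) ?_ ?_ ?_ ?_ ?_ <;>
        intro U hU <;> obtain ⟨hUV, hP⟩ := Finset.mem_filter.1 hU <;>
        have hUV := Finset.mem_powerset.1 hUV
      · exact Finset.mem_filter.2 ⟨Finset.mem_powerset.2 Finset.sdiff_subset, hP⟩
      · refine Finset.mem_filter.2 ⟨Finset.mem_powerset.2 Finset.sdiff_subset, ?_⟩
        rwa [Finset.sdiff_sdiff_eq_self hUV]
      · exact Finset.sdiff_sdiff_eq_self hUV
      · exact Finset.sdiff_sdiff_eq_self hUV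
      · rw [Finset.sdiff_sdiff_eq_self hUV, mul_comm]
    have swap_all := fun V : Finset ℕ => swap V fun _ => True
    simp only [Finset.filter_true] at swap_all
    have hnot : ∀ U ∈ S.powerset, (¬ M ∈ U ↔ M ∈ S \ U) := fun U _ => by simp [hM]
    rw [← Finset.sum_filter_add_sum_filter_not S.powerset (M ∈ ·), Finset.filter_congr hnot,
      swap S (M ∈ ·), half s t ih', half t s fun T hT hMT => by
        rw [add_comm t s, ih' T hT hMT, swap_all],
      add_comm t s, compartmentSum_eq hM hmax, add_mul]

theorem compartmentSum_eq_raney (m : ℕ) (S : Finset ℕ) (t : ℕ) :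
    compartmentSum m S t = raney m S.card t := by
  induction t generalizing S with
  | zero =>
    rcases S.eq_empty_or_nonempty with rfl | hS
    · simp [compartmentSum_empty, raney_zero]
    · rw [Nat.cast_zero, compartmentSum_eq (S.max'_mem hS) fun x hx => S.le_max' x hx, zero_mul,
        raney_apply_zero, if_neg (Finset.card_ne_zero.2 hS)]
  | succ t ih =>
    rw [Nat.cast_succ, add_comm, compartmentSum_add, ← sum_powerset_raney_mul_raney]
    exact Finset.sum_congr rfl fun U _ => by rw [compartmentSum_one, ih]

/-! ### Decorated paths -/

/-- The pairs of labeled Dyck paths whose label sets partition `S`. -/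
noncomputable def pathPairs (m : ℕ) (S : Finset ℕ) : Finset (List LStep × List LStep) :=
  S.powerset.biUnion fun U => dyckPaths m U ×ˢ dyckPaths m (S \ U)

theorem sum_pathPairs {R : Type*} [CommSemiring R] (m : ℕ) (S : Finset ℕ)
    (f : List LStep × List LStep → R) :
    ∑ q ∈ pathPairs m S, f q =
      ∑ U ∈ S.powerset, ∑ u ∈ dyckPaths m U, ∑ v ∈ dyckPaths m (S \ U), f (u, v) := by
  rw [pathPairs, Finset.sum_biUnion]
  · simp only [Finset.sum_product]
  · intro U _ U' _ hne
    refine Finset.disjoint_left.2 fun q hq hq' => hne ?_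
    rw [Finset.mem_product, mem_dyckPaths] at hq hq'
    exact hq.1.labels.symm.trans hq'.1.labels

/-- The enumerator of decorated paths by the number of compartments of the second path. -/
theorem sum_pathPairs_X_pow (m p : ℕ) :
    ∑ q ∈ pathPairs m (Finset.Icc 1 (p + 1)), (X : ℤ[X]) ^ (compartments m q.2).length =
      (X + 1) * ∏ i ∈ Finset.range p, (X + 1 + C ((m * (p + 1) + i + 1 : ℕ) : ℤ)) := by
  refine eq_of_infinite_eval_eq _ _ (Set.Infinite.mono ?_ (Set.infinite_range_of_injective
    (f := fun r : ℕ => (r : ℤ)) fun r s h => by simpa using h))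
  rintro _ ⟨r, rfl⟩
  have h1 : ∑ q ∈ pathPairs m (Finset.Icc 1 (p + 1)), (r : ℤ) ^ (compartments m q.2).length =
      compartmentSum m (Finset.Icc 1 (p + 1)) (1 + r) := by
    rw [sum_pathPairs, compartmentSum_add]
    refine Finset.sum_congr rfl fun U _ => ?_
    rw [compartmentSum, compartmentSum, Finset.sum_mul]
    simp
  have h2 := compartmentSum_eq_raney m (Finset.Icc 1 (p + 1)) (1 + r)
  rw [Nat.cast_add, Nat.cast_one, ← h1, Nat.card_Icc, Nat.add_sub_cancel, raney] at h2
  simp only [Set.mem_ofPred_eq, eval_finsetSum, eval_pow, eval_X, eval_mul, eval_add, eval_one,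
    eval_C, eval_prod]
  rw [h2, add_comm (1 : ℤ)]
  congr 1
  refine Finset.prod_congr rfl fun i _ => ?_
  push_cast
  ring

theorem encard_decoratedDyckPath (m n j : ℕ) :
    {D : DecoratedDyckPath m n | (compartments m D.second).length = j}.encard =
      ((pathPairs m (Finset.Icc 1 n)).filter fun q => (compartments m q.2).length = j).card := by
  have hinj : Function.Injective fun D : DecoratedDyckPath m n => (D.first, D.second) := by
    rintro ⟨w, hw, k, hk, hk0⟩ ⟨w', hw', k', hk', hk0'⟩ h
    simp only [DecoratedDyckPath.first, DecoratedDyckPath.second, Prod.mk.injEq] at h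
    have e1 : w = w' := by
      rw [← List.take_append_drop k w, h.1, h.2, List.take_append_drop]
    have e2 : k = k' := by
      have := congrArg List.length h.1
      rw [List.length_take, List.length_take] at this
      omega
    subst e1 e2
    rfl
  rw [← hinj.injOn.encard_image, ← Set.encard_coe_eq_coe_finsetCard]
  congr 1
  ext ⟨u, v⟩
  simp only [Set.mem_image, Set.mem_ofPred_eq, Finset.coe_filter, pathPairs, Finset.mem_biUnion,
    Finset.mem_powerset, Finset.mem_product, mem_dyckPaths, Prod.mk.injEq]
  constructor
  · rintro ⟨D, hD, rfl, rfl⟩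
    refine ⟨?_, hD⟩
    have hw : IsPathFrom m 0 (Finset.Icc 1 n) (D.first ++ D.second) := by
      rw [DecoratedDyckPath.first, DecoratedDyckPath.second, List.take_append_drop]
      exact isLabeledDyckPath_iff.1 D.isLabeledDyckPath
    obtain ⟨hU, h⟩ := hw.of_append D.point_on_axis
    exact ⟨_, hU, h⟩
  · rintro ⟨⟨U, hU, hu, hv⟩, hj⟩
    have hw := hu.append hv Finset.disjoint_sdiff
    rw [Finset.union_sdiff_of_subset hU] at hw
    exact ⟨⟨u ++ v, isLabeledDyckPath_iff.2 hw, u.length, by simp, by simpa using hu.ends⟩,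
      by simpa [DecoratedDyckPath.second] using hj, by simp [DecoratedDyckPath.first],
      by simp [DecoratedDyckPath.second]⟩

theorem mainTheorem5 (m n : ℕ) (hm : 1 ≤ m) (hn : 1 ≤ n) (a : ℝ) (ha : 1 < a) (j : ℕ) :
    (((expCatalan n m a).charPoly.coeff j).natAbs : ℕ∞) =
      {D : DecoratedDyckPath m n | (compartments m D.second).length = j}.encard := by
  obtain ⟨p, rfl⟩ := Nat.exists_eq_add_one_of_ne_zero (Nat.one_le_iff_ne_zero.1 hn)
  set P : ℤ[X] := ∑ q ∈ pathPairs m (Finset.Icc 1 (p + 1)), X ^ (compartments m q.2).length with hP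
  -- The two enumerators differ by the substitution `X ↦ -X` and a sign.
  have hrel : (expCatalan (p + 1) m a).charPoly = C ((-1) ^ (p + 1)) * P.comp (C (-1) * X) := by
    rw [hP, sum_pathPairs_X_pow, charPoly_expCatalan p m ha, mul_comp, prod_comp, pow_succ', C_mul,
      mul_mul_mul_comm, C_pow,
      show (C (-1) : ℤ[X]) ^ p = ∏ _i ∈ Finset.range p, C (-1) by simp, ← Finset.prod_mul_distrib]
    congr 1
    · simp
      ring
    · refine Finset.prod_congr rfl fun i _ => ?_
      simp
      ring
  have hcoeff : P.coeff j = ((pathPairs m (Finset.Icc 1 (p + 1))).filter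
      fun q => (compartments m q.2).length = j).card := by
    simp only [hP, finsetSum_coeff, coeff_X_pow, eq_comm (a := j), Finset.sum_boole]
  rw [encard_decoratedDyckPath, hrel, coeff_C_mul, comp_C_mul_X_coeff, hcoeff]
  simp [Int.natAbs_mul, Int.natAbs_pow]
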